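/- Let $k$ be an algebraically closed field of characteristic zero and let $H$ be a semisimple Hopf algebra over $k$ (that is, $H$ is semisimple as a ring). A Hopf subalgebra $A \subseteq H$ is *normal* if $\sum h_1 a S(h_2) \in A$ and $\sum S(h_1) a h_2 \in A$ for all $h \in H$, $a \in A$; a *minimal normal Hopf subalgebra* is a minimal element, with respect to inclusion, of the set of normal Hopf subalgebras of $H$ different from $k = k1_H$. The *socle* $\mathrm{Soc}(H)$ is the Hopf subalgebra of $H$ generated by all minimal normal Hopf subalgebras of $H$. **Theorem 5.2.** The socle of $H$ is the tensor product of some of its minimal normal Hopf subalgebras. Precisely, there are finitely many pairwise distinct minimal normal Hopf subalgebras $L_1, \dots, L_s$ of $H$ ($s \ge 0$) such that $\mathrm{Soc}(H)$ is the internal tensor product of $L_1, \dots, L_s$, meaning that $\mathrm{Soc}(H)$ is the Hopf subalgebra generated by $L_1, \dots, L_s$ and, for each $j$, the intersection of $L_j$ with the Hopf subalgebra generated by all $L_i$, $i \ne j$, is $k$; and such that the multiplication map $a_1 \otimes \cdots \otimes a_s \mapsto a_1 \cdots a_s$ is an isomorphism of Hopf algebras $$L_1 \otimes \cdots \otimes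 L_s \;\cong\; \mathrm{Soc}(H).$$ For $s = 0$ the empty tensor product is $k$ and $\mathrm{Soc}(H) = k$. -/

import Mathlib

open scoped TensorProduct

universe u v

/-- A Hopf subalgebra of a Hopf algebra `H` over a field `k`: a (unital) subalgebra `A` with
`Δ(A) ⊆ A ⊗ A` (viewed inside `H ⊗ H`) and `S(A) ⊆ A`. -/
structure HopfSubalgebra (k : Type u) (H : Type v) [Field k] [Ring H] [HopfAlgebra k H]
    extends Subalgebra k H where
  comul_mem' : ∀ a ∈ toSubalgebra, Bialgebra.comulAlgHom k H a ∈
    (Algebra.TensorProduct.map toSubalgebra.val toSubalgebra.val).range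
  antipode_mem' : ∀ a ∈ toSubalgebra, HopfAlgebra.antipode k a ∈ toSubalgebra

namespace HopfSubalgebra

variable {k : Type u} {H : Type v} [Field k] [Ring H] [HopfAlgebra k H]

theorem toSubalgebra_injective :
    Function.Injective (toSubalgebra : HopfSubalgebra k H → Subalgebra k H) := by
  rintro ⟨A, _, _⟩ ⟨B, _, _⟩ h
  cases h
  rfl

/-- Hopf subalgebras are ordered by inclusion. -/
instance : PartialOrder (HopfSubalgebra k H) :=
  PartialOrder.lift toSubalgebra toSubalgebra_injective

theorem le_def {A B : HopfSubalgebra k H} : A ≤ B ↔ A.toSubalgebra ≤ B.toSubalgebra := Iff.rfl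

theorem range_map_mono {A B : Subalgebra k H} (h : A ≤ B) :
    (Algebra.TensorProduct.map A.val A.val).range ≤
      (Algebra.TensorProduct.map B.val B.val).range := by
  have e : Algebra.TensorProduct.map A.val A.val =
      (Algebra.TensorProduct.map B.val B.val).comp
        (Algebra.TensorProduct.map (Subalgebra.inclusion h) (Subalgebra.inclusion h)) := by
    ext <;> simp
  rw [e]
  rintro _ ⟨x, rfl⟩
  exact ⟨_, rfl⟩

/-- The Hopf subalgebra generated by a set of Hopf subalgebras: its underlying algebra is the
subalgebra generated by them. It is their least upper bound, see `isLUB_generated`. -/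
def generated (T : Set (HopfSubalgebra k H)) : HopfSubalgebra k H where
  toSubalgebra := Algebra.adjoin k (⋃ A ∈ T, (A.toSubalgebra : Set H))
  comul_mem' := by
    set S := Algebra.adjoin k (⋃ A ∈ T, (A.toSubalgebra : Set H)) with hS
    suffices S ≤ (Algebra.TensorProduct.map S.val S.val).range.comap
      (Bialgebra.comulAlgHom k H) from fun a ha ↦ this ha
    conv_lhs => rw [hS]
    refine Algebra.adjoin_le fun a ha ↦ ?_
    obtain ⟨A, hA, ha⟩ := Set.mem_iUnion₂.1 ha
    have hle : A.toSubalgebra ≤ S := fun x hx ↦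
      Algebra.subset_adjoin (Set.mem_iUnion₂.2 ⟨A, hA, hx⟩)
    exact range_map_mono hle (A.comul_mem' a ha)
  antipode_mem' := by
    intro a ha
    induction ha using Algebra.adjoin_induction with
    | mem x hx =>
      obtain ⟨A, hA, hx⟩ := Set.mem_iUnion₂.1 hx
      exact Algebra.subset_adjoin (Set.mem_iUnion₂.2 ⟨A, hA, A.antipode_mem' x hx⟩)
    | algebraMap r =>
      rw [Algebra.algebraMap_eq_smul_one, map_smul, HopfAlgebra.antipode_one]
      exact Subalgebra.smul_mem _ (one_mem _) r
    | add x y _ _ hx hy => rw [map_add]; exact add_mem hx hy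
    | mul x y _ _ hx hy =>
      rw [HopfAlgebra.antipode_mul_antidistrib]; exact mul_mem hy hx

theorem isLUB_generated (T : Set (HopfSubalgebra k H)) : IsLUB T (generated T) :=
  ⟨fun A hA _ hx ↦ Algebra.subset_adjoin (Set.mem_iUnion₂.2 ⟨A, hA, hx⟩),
    fun _ hB ↦ Algebra.adjoin_le (Set.iUnion₂_subset fun _ hA ↦ hB hA)⟩

/-- The least Hopf subalgebra of `H` is the trivial one, `k ⊆ H`. -/
instance : OrderBot (HopfSubalgebra k H) where
  bot :=
    { toSubalgebra := ⊥
      comul_mem' := by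
        intro a ha
        obtain ⟨r, rfl⟩ := Algebra.mem_bot.1 ha
        rw [AlgHom.commutes]
        exact Subalgebra.algebraMap_mem _ r
      antipode_mem' := by
        intro a ha
        obtain ⟨r, rfl⟩ := Algebra.mem_bot.1 ha
        rw [Algebra.algebraMap_eq_smul_one, map_smul, HopfAlgebra.antipode_one]
        exact Subalgebra.smul_mem _ (one_mem _) r }
  bot_le A := (bot_le : (⊥ : Subalgebra k H) ≤ A.toSubalgebra)

section HopfStructure

variable (A : HopfSubalgebra k H)

theorem map_val_injective : Function.Injective
    (Algebra.TensorProduct.map A.toSubalgebra.val A.toSubalgebra.val) :=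
  TensorProduct.map_injective_of_flat_flat A.toSubalgebra.val.toLinearMap
    A.toSubalgebra.val.toLinearMap Subtype.val_injective Subtype.val_injective

/-- The comultiplication of `H` restricted to a Hopf subalgebra. -/
noncomputable def comulRestrict :
    A.toSubalgebra →ₐ[k] A.toSubalgebra ⊗[k] A.toSubalgebra :=
  (AlgEquiv.ofInjective _ A.map_val_injective).symm.toAlgHom.comp
    (((Bialgebra.comulAlgHom k H).comp A.toSubalgebra.val).codRestrict _
      fun a ↦ A.comul_mem' a a.2)

theorem map_comulRestrict (a : A.toSubalgebra) :
    Algebra.TensorProduct.map A.toSubalgebra.val A.toSubalgebra.val (A.comulRestrict a) =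
      Coalgebra.comul (R := k) (a : H) := by
  have := (AlgEquiv.ofInjective _ A.map_val_injective).apply_symm_apply
    ((((Bialgebra.comulAlgHom k H).comp A.toSubalgebra.val).codRestrict _
      fun a ↦ A.comul_mem' a a.2) a)
  exact congrArg Subtype.val this

theorem map_comp_comulRestrict :
    (Algebra.TensorProduct.map A.toSubalgebra.val A.toSubalgebra.val).comp A.comulRestrict =
      (Bialgebra.comulAlgHom k H).comp A.toSubalgebra.val :=
  AlgHom.ext A.map_comulRestrict

/-- A Hopf subalgebra is a bialgebra with the restricted operations. -/
noncomputable instance instBialgebra : Bialgebra k A.toSubalgebra :=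
  Bialgebra.ofAlgHom A.comulRestrict ((Bialgebra.counitAlgHom k H).comp A.toSubalgebra.val)
    (by
      have hinj : Function.Injective (Algebra.TensorProduct.map A.toSubalgebra.val
          (Algebra.TensorProduct.map A.toSubalgebra.val A.toSubalgebra.val)) :=
        TensorProduct.map_injective_of_flat_flat A.toSubalgebra.val.toLinearMap
          (Algebra.TensorProduct.map A.toSubalgebra.val A.toSubalgebra.val).toLinearMap
          Subtype.val_injective A.map_val_injective
      rw [← AlgHom.cancel_left hinj]
      have h1 : (Algebra.TensorProduct.map A.toSubalgebra.val
          (Algebra.TensorProduct.map A.toSubalgebra.val A.toSubalgebra.val)).comp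
            (Algebra.TensorProduct.assoc k k k _ _ _).toAlgHom =
          (Algebra.TensorProduct.assoc k k k H H H).toAlgHom.comp
            (Algebra.TensorProduct.map (Algebra.TensorProduct.map A.toSubalgebra.val
              A.toSubalgebra.val) A.toSubalgebra.val) := by
        ext <;> rfl
      have h2 : (Algebra.TensorProduct.map (Algebra.TensorProduct.map A.toSubalgebra.val
              A.toSubalgebra.val) A.toSubalgebra.val).comp
            (Algebra.TensorProduct.map A.comulRestrict (.id k _)) =
          (Algebra.TensorProduct.map (Bialgebra.comulAlgHom k H) (.id k H)).comp
            (Algebra.TensorProduct.map A.toSubalgebra.val A.toSubalgebra.val) := by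
        rw [← Algebra.TensorProduct.map_comp, map_comp_comulRestrict,
          ← Algebra.TensorProduct.map_comp]
        rfl
      have h3 : (Algebra.TensorProduct.map A.toSubalgebra.val (Algebra.TensorProduct.map
              A.toSubalgebra.val A.toSubalgebra.val)).comp
            (Algebra.TensorProduct.map (.id k _) A.comulRestrict) =
          (Algebra.TensorProduct.map (.id k H) (Bialgebra.comulAlgHom k H)).comp
            (Algebra.TensorProduct.map A.toSubalgebra.val A.toSubalgebra.val) := by
        rw [← Algebra.TensorProduct.map_comp, map_comp_comulRestrict,
          ← Algebra.TensorProduct.map_comp]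
        rfl
      rw [← AlgHom.comp_assoc, ← AlgHom.comp_assoc, h1,
        AlgHom.comp_assoc (Algebra.TensorProduct.assoc k k k H H H).toAlgHom, h2,
        ← AlgHom.comp_assoc _ (Algebra.TensorProduct.map (.id k A.toSubalgebra) A.comulRestrict),
        h3]
      simp only [AlgHom.comp_assoc, map_comp_comulRestrict]
      ext a
      exact Coalgebra.coassoc_apply (R := k) (a : H))
    (by
      have hinj : Function.Injective (Algebra.TensorProduct.map (.id k k) A.toSubalgebra.val) :=
        TensorProduct.map_injective_of_flat_flat (LinearMap.id : k →ₗ[k] k)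
          A.toSubalgebra.val.toLinearMap Function.injective_id Subtype.val_injective
      rw [← AlgHom.cancel_left hinj, ← AlgHom.comp_assoc, ← Algebra.TensorProduct.map_comp]
      have h : Algebra.TensorProduct.map
            ((AlgHom.id k k).comp ((Bialgebra.counitAlgHom k H).comp A.toSubalgebra.val))
            (A.toSubalgebra.val.comp (.id k _)) =
          (Algebra.TensorProduct.map (Bialgebra.counitAlgHom k H) (.id k H)).comp
            (Algebra.TensorProduct.map A.toSubalgebra.val A.toSubalgebra.val) := by
        rw [← Algebra.TensorProduct.map_comp]
        rfl
      rw [h, AlgHom.comp_assoc, map_comp_comulRestrict]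
      ext a
      exact Coalgebra.rTensor_counit_comul (R := k) (a : H))
    (by
      have hinj : Function.Injective (Algebra.TensorProduct.map A.toSubalgebra.val (.id k k)) :=
        TensorProduct.map_injective_of_flat_flat A.toSubalgebra.val.toLinearMap
          (LinearMap.id : k →ₗ[k] k) Subtype.val_injective Function.injective_id
      rw [← AlgHom.cancel_left hinj, ← AlgHom.comp_assoc, ← Algebra.TensorProduct.map_comp]
      have h : Algebra.TensorProduct.map (A.toSubalgebra.val.comp (.id k _))
            ((AlgHom.id k k).comp ((Bialgebra.counitAlgHom k H).comp A.toSubalgebra.val)) =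
          (Algebra.TensorProduct.map (.id k H) (Bialgebra.counitAlgHom k H)).comp
            (Algebra.TensorProduct.map A.toSubalgebra.val A.toSubalgebra.val) := by
        rw [← Algebra.TensorProduct.map_comp]
        rfl
      rw [h, AlgHom.comp_assoc, map_comp_comulRestrict]
      ext a
      exact Coalgebra.lTensor_counit_comul (R := k) (a : H))

/-- The antipode of `H` restricted to a Hopf subalgebra. -/
noncomputable def antipodeRestrict : A.toSubalgebra →ₗ[k] A.toSubalgebra :=
  LinearMap.restrict (p := Subalgebra.toSubmodule A.toSubalgebra)
    (q := Subalgebra.toSubmodule A.toSubalgebra) (HopfAlgebra.antipode k) A.antipode_mem'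

/-- A Hopf subalgebra is a Hopf algebra with the restricted operations. -/
noncomputable instance instHopfAlgebra : HopfAlgebra k A.toSubalgebra where
  antipode := A.antipodeRestrict
  mul_antipode_rTensor_comul := by
    ext a
    have h : ∀ x : A.toSubalgebra ⊗[k] A.toSubalgebra,
        (LinearMap.mul' k A.toSubalgebra (A.antipodeRestrict.rTensor _ x) : H) =
          LinearMap.mul' k H ((HopfAlgebra.antipode k).rTensor H
            (Algebra.TensorProduct.map A.toSubalgebra.val A.toSubalgebra.val x)) := by
      intro x
      induction x with
      | zero => simp
      | tmul x y => rfl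
      | add x y hx hy => simp only [map_add, hx, hy, Subalgebra.coe_add]
    refine (h (A.comulRestrict a)).trans ?_
    rw [map_comulRestrict]
    exact HopfAlgebra.mul_antipode_rTensor_comul_apply (R := k) (a : H)
  mul_antipode_lTensor_comul := by
    ext a
    have h : ∀ x : A.toSubalgebra ⊗[k] A.toSubalgebra,
        (LinearMap.mul' k A.toSubalgebra (A.antipodeRestrict.lTensor _ x) : H) =
          LinearMap.mul' k H ((HopfAlgebra.antipode k).lTensor H
            (Algebra.TensorProduct.map A.toSubalgebra.val A.toSubalgebra.val x)) := by
      intro x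
      induction x with
      | zero => simp
      | tmul x y => rfl
      | add x y hx hy => simp only [map_add, hx, hy, Subalgebra.coe_add]
    refine (h (A.comulRestrict a)).trans ?_
    rw [map_comulRestrict]
    exact HopfAlgebra.mul_antipode_lTensor_comul_apply (R := k) (a : H)

end HopfStructure

/-- The left adjoint action `h ⊗ a ↦ ∑ h₁ a S(h₂)` (for fixed `a`, linear in `h`). -/
noncomputable def leftAdjoint (a : H) : H →ₗ[k] H :=
  LinearMap.mul' k H ∘ₗ
    TensorProduct.map (LinearMap.mulRight k a) (HopfAlgebra.antipode k) ∘ₗ Coalgebra.comul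

/-- The right adjoint action `h ⊗ a ↦ ∑ S(h₁) a h₂` (for fixed `a`, linear in `h`). -/
noncomputable def rightAdjoint (a : H) : H →ₗ[k] H :=
  LinearMap.mul' k H ∘ₗ
    TensorProduct.map (LinearMap.mulRight k a ∘ₗ HopfAlgebra.antipode k) LinearMap.id ∘ₗ
      Coalgebra.comul

/-- A Hopf subalgebra `A` is normal if `∑ h₁ A S(h₂) ⊆ A` and `∑ S(h₁) A h₂ ⊆ A` for all `h`. -/
def IsNormal (A : HopfSubalgebra k H) : Prop :=
  ∀ h : H, ∀ a ∈ A.toSubalgebra,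
    leftAdjoint (k := k) a h ∈ A.toSubalgebra ∧ rightAdjoint (k := k) a h ∈ A.toSubalgebra

/-- A minimal normal Hopf subalgebra: minimal among the normal Hopf subalgebras other
than the trivial one `k`. -/
def IsMinimalNormal (A : HopfSubalgebra k H) : Prop :=
  Minimal (fun B : HopfSubalgebra k H ↦ B.IsNormal ∧ B ≠ ⊥) A

variable (k H) in
/-- The socle of `H`: the Hopf subalgebra generated by all minimal normal Hopf subalgebras. -/
def socle : HopfSubalgebra k H :=
  generated {A | A.IsMinimalNormal}

/-- `S` is the internal tensor product of a set `T` of Hopf subalgebras: it is generated by `T`,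
and each member of `T` meets the Hopf subalgebra generated by the others in `k`. -/
def IsInternalTensorProduct (T : Set (HopfSubalgebra k H)) (S : HopfSubalgebra k H) : Prop :=
  S = generated T ∧
    ∀ A ∈ T, A.toSubalgebra ⊓ (generated (T \ {A})).toSubalgebra = ⊥

/-- The tensor product Hopf algebra `A₁ ⊗ (A₂ ⊗ (⋯ ⊗ (Aₙ ⊗ k)))` of a finite list of Hopf
subalgebras, where the last factor `k` is the trivial Hopf subalgebra. -/
noncomputable def tensorList : List (HopfSubalgebra k H) → HopfAlgCat.{v} k
  | [] => HopfAlgCat.of k (⊥ : HopfSubalgebra k H).toSubalgebra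
  | A :: l => HopfAlgCat.of k (A.toSubalgebra ⊗[k] tensorList l)

/-- The multiplication map `a₁ ⊗ (a₂ ⊗ (⋯ ⊗ (aₙ ⊗ c))) ↦ a₁ a₂ ⋯ aₙ c` into `H`. -/
noncomputable def mulList : (l : List (HopfSubalgebra k H)) → (tensorList l →ₗ[k] H)
  | [] => (⊥ : HopfSubalgebra k H).toSubalgebra.val.toLinearMap
  | A :: l => LinearMap.mul' k H ∘ₗ
      TensorProduct.map A.toSubalgebra.val.toLinearMap (mulList l)

end HopfSubalgebra

-- The argument follows the group case. Semisimplicity gives a left integral of nonzero counit,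
-- hence finite dimension (`finite_of_isSemisimpleRing`), so finitely many minimal normal Hopf
-- subalgebras generate the socle. Take such a family of least cardinality. A minimal normal Hopf
-- subalgebra meets a normal one in `k` or lies inside it, and normal Hopf subalgebras generate a
-- normal one; so a member not independent of the others would be redundant. Hence the family is
-- independent.
--
-- Normal Hopf subalgebras `A`, `B` with `A ∩ B = k` commute (`commute_of_inf_eq_bot`): the Hopf
-- commutator `∑ a₁ b₁ S(a₂) S(b₂)` lies in both, hence is a scalar. Multiplication is therefore a
-- Hopf algebra map, and one adds the factors one at a time.
--
-- The substance is injectivity of `F : b ⊗ c ↦ bc`. Its right coinvariants are trivial because `A ∩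
-- B = k` (`eq_smul_one_of_coinvariant`). The image, being finite-dimensional, carries a nonzero
-- integral functional, constructed as a trace (`exists_integral_functional`). With trivial
-- coinvariants, its pullback along `F` is again an integral; the left ideal on which this pullback
-- degenerates contains `ker F` and must vanish (`injective_of_coinvariants_trivial`).

universe w

/-! ### Antipode identities in the convolution algebra -/

namespace HopfAlgebra

section Convolution

variable {k : Type u} {A : Type v} [Field k] [Ring A] [HopfAlgebra k A]

open WithConv LinearMap

local notation "ιₗ" => Algebra.TensorProduct.includeLeft (R := k) (S := k) (A := A) (B := A)
local notation "ιᵣ" => Algebra.TensorProduct.includeRight (R := k) (A := A) (B := A)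

theorem toConv_includeLeft_mul_includeRight :
    toConv (ιₗ).toLinearMap * toConv (ιᵣ).toLinearMap =
      toConv (Coalgebra.comul (R := k) (A := A)) := by
  ext a
  rw [(Coalgebra.Repr.arbitrary k a).convMul_apply]
  conv_rhs => rw [← toConv_ofConv (toConv Coalgebra.comul)]
  simp [Algebra.TensorProduct.tmul_mul_tmul, Coalgebra.Repr.eq]

theorem toConv_algHom_comp_antipode_mul {B : Type*} [Ring B] [Algebra k B] (f : A →ₐ[k] B) :
    toConv (f.toLinearMap ∘ₗ antipode k) * toConv f.toLinearMap = 1 := by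
  have := congrArg toConv
    (algHom_comp_convMul_distrib f (toConv (antipode k (A := A))) (toConv LinearMap.id))
  rw [antipode_mul_id] at this
  ext a
  simpa using (LinearMap.congr_fun (congrArg ofConv this) a).symm

/-- The antipode reverses comultiplication: both sides are convolution inverses of `Δ`, which
factors as `ιₗ * ιᵣ`. -/
theorem toConv_comul_comp_antipode :
    toConv (Coalgebra.comul ∘ₗ antipode k) =
      toConv ((ιᵣ).toLinearMap ∘ₗ antipode k) * toConv ((ιₗ).toLinearMap ∘ₗ antipode k) := by
  symm
  apply left_inv_eq_right_inv (a := toConv (Coalgebra.comul (R := k) (A := A)))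
  · rw [← toConv_includeLeft_mul_includeRight, mul_assoc,
      ← mul_assoc (toConv ((ιₗ).toLinearMap ∘ₗ antipode k)) (toConv (ιₗ).toLinearMap),
      toConv_algHom_comp_antipode_mul ιₗ, one_mul, toConv_algHom_comp_antipode_mul ιᵣ]
  · exact comul_right_inv

/-- `∑ (S(a₁) ⊗ 1) Δ(a₂) = 1 ⊗ a`. -/
theorem includeLeft_antipode_convMul_comul :
    toConv ((ιₗ).toLinearMap ∘ₗ antipode k) * toConv (Coalgebra.comul (R := k) (A := A)) =
      toConv (ιᵣ).toLinearMap := by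
  rw [← toConv_includeLeft_mul_includeRight, ← mul_assoc, toConv_algHom_comp_antipode_mul ιₗ,
    one_mul]

/-- `∑ Δ(S(a₁)) (a₂ ⊗ 1) = 1 ⊗ S(a)`. -/
theorem comul_antipode_convMul_includeLeft :
    toConv (Coalgebra.comul ∘ₗ antipode k) * toConv (ιₗ).toLinearMap =
      toConv ((ιᵣ).toLinearMap ∘ₗ antipode k) := by
  rw [toConv_comul_comp_antipode, mul_assoc, toConv_algHom_comp_antipode_mul ιₗ, mul_one]

theorem sum_antipode_tmul_one_mul_comul {ι : Type*} {a : A} (r : Coalgebra.Repr k a ι) :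
    ∑ i ∈ r.index, antipode k (r.left i) ⊗ₜ[k] (1 : A) * Coalgebra.comul (R := k) (r.right i) =
      1 ⊗ₜ a := by
  simpa [r.convMul_apply] using
    LinearMap.congr_fun (congrArg ofConv (includeLeft_antipode_convMul_comul (k := k) (A := A))) a

theorem sum_comul_antipode_mul_tmul_one {ι : Type*} {a : A} (r : Coalgebra.Repr k a ι) :
    ∑ i ∈ r.index, Coalgebra.comul (R := k) (antipode k (r.left i)) * r.right i ⊗ₜ[k] (1 : A) =
      1 ⊗ₜ antipode k a := by
  simpa [r.convMul_apply] using
    LinearMap.congr_fun (congrArg ofConv (comul_antipode_convMul_includeLeft (k := k) (A := A))) a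

/-- `∑ Δ(S²(a₂)) (S(a₁) ⊗ 1) = 1 ⊗ S²(a)`. -/
theorem sum_comul_antipode_antipode_mul_tmul_one {ι : Type*} {a : A}
    (r : Coalgebra.Repr k a ι) :
    ∑ i ∈ r.index, Coalgebra.comul (R := k) (antipode k (antipode k (r.right i))) *
      antipode k (r.left i) ⊗ₜ[k] (1 : A) = 1 ⊗ₜ antipode k (antipode k a) := by
  have h : Coalgebra.comul (R := k) (antipode k a) =
      ∑ i ∈ r.index, antipode k (r.right i) ⊗ₜ antipode k (r.left i) := by
    have := LinearMap.congr_fun (congrArg ofConv (toConv_comul_comp_antipode (k := k) (A := A))) a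
    simpa [r.convMul_apply] using this
  exact sum_comul_antipode_mul_tmul_one
    (⟨r.index, fun i ↦ antipode k (r.right i), fun i ↦ antipode k (r.left i), h.symm⟩ :
      Coalgebra.Repr k (antipode k a) ι)

end Convolution

end HopfAlgebra

/-! ### Slices of tensors -/

section TensorSlice

variable {k : Type*} {M : Type w} {N : Type*} [Field k] [AddCommGroup M] [Module k M] [AddCommGroup N]
  [Module k N]

/-- The slice map `M ⊗ N → N` of a functional on `M`. -/
noncomputable def TensorProduct.sliceLeft (φ : Module.Dual k M) : M ⊗[k] N →ₗ[k] N :=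
  TensorProduct.lid k N ∘ₗ φ.rTensor N

/-- The slice map `M ⊗ N → M` of a functional on `N`. -/
noncomputable def TensorProduct.sliceRight (φ : Module.Dual k N) : M ⊗[k] N →ₗ[k] M :=
  TensorProduct.rid k M ∘ₗ φ.lTensor M

open TensorProduct

@[simp] theorem TensorProduct.sliceLeft_tmul (φ : Module.Dual k M) (m : M) (n : N) :
    sliceLeft φ (m ⊗ₜ[k] n) = φ m • n := rfl

@[simp] theorem TensorProduct.sliceRight_tmul (φ : Module.Dual k N) (m : M) (n : N) :
    sliceRight φ (m ⊗ₜ[k] n) = φ n • m := rfl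

/-- An element of `M ⊗ N` is a sum of elementary tensors built from its own left slices. -/
theorem TensorProduct.exists_eq_sum_tmul_sliceLeft (t : M ⊗[k] N) :
    ∃ (ι : Type w) (s : Finset ι) (m : ι → M) (φ : ι → Module.Dual k M),
      t = ∑ i ∈ s, m i ⊗ₜ sliceLeft (φ i) t := by
  classical
  let b := Module.Basis.ofVectorSpace k M
  refine ⟨_, ((equivFinsuppOfBasisLeft b) t).support, b, b.coord, ?_⟩
  conv_lhs => rw [← (equivFinsuppOfBasisLeft (N := N) b).symm_apply_apply t]
  rw [equivFinsuppOfBasisLeft_symm_apply]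
  simp only [Finsupp.sum, equivFinsuppOfBasisLeft_apply]
  rfl

theorem TensorProduct.ext_sliceLeft {s t : M ⊗[k] N} (h : ∀ φ, sliceLeft φ s = sliceLeft φ t) :
    s = t := by
  rw [← sub_eq_zero]
  obtain ⟨ι, I, m, φ, e⟩ := exists_eq_sum_tmul_sliceLeft (s - t)
  rw [e]
  exact Finset.sum_eq_zero fun i _ ↦ by rw [map_sub, h, sub_self, tmul_zero]

end TensorSlice

/-! ### Integrals: finite dimension and an injectivity criterion -/

namespace HopfAlgebra

variable {k : Type u} {A : Type v} [Field k] [Ring A] [HopfAlgebra k A]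

open TensorProduct LinearMap

/-- The operator `a ↦ ∑ a₁ φ(a₂)`. -/
noncomputable def rightTranslate (φ : Module.Dual k A) : A →ₗ[k] A :=
  sliceRight φ ∘ₗ Coalgebra.comul

theorem rightTranslate_apply (φ : Module.Dual k A) (a : A) :
    rightTranslate φ a = sliceRight φ (Coalgebra.comul a) := rfl

theorem counit_rightTranslate (φ : Module.Dual k A) (a : A) :
    Coalgebra.counit (R := k) (rightTranslate φ a) = φ a := by
  have h : ∀ t : A ⊗[k] A, Coalgebra.counit (R := k) (sliceRight φ t) =
      φ (TensorProduct.lid k A (Coalgebra.counit.rTensor A t)) := by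
    intro t
    induction t with
    | zero => simp
    | tmul x y => simp [mul_comm]
    | add x y hx hy => simp only [map_add, hx, hy]
  rw [rightTranslate_apply, h]
  simp

theorem comul_rightTranslate (φ : Module.Dual k A) (a : A) :
    Coalgebra.comul (R := k) (rightTranslate φ a) =
      (rightTranslate φ).lTensor A (Coalgebra.comul a) := by
  have h1 : ∀ t : A ⊗[k] A, Coalgebra.comul (R := k) (sliceRight φ t) =
      sliceRight φ (Coalgebra.comul.rTensor A t) := by
    intro t
    induction t with
    | zero => simp
    | tmul x y => simp
    | add x y hx hy => simp only [map_add, hx, hy]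
  have h2 : ∀ t : (A ⊗[k] A) ⊗[k] A, sliceRight φ t =
      (sliceRight φ).lTensor A (TensorProduct.assoc k A A A t) := by
    intro t
    induction t with
    | zero => simp
    | tmul x y =>
      induction x with
      | zero => simp
      | tmul x z => simp
      | add x z hx hz => simp only [map_add, hx, hz, add_tmul]
    | add x y hx hy => simp only [map_add, hx, hy]
  rw [rightTranslate_apply, h1, h2, Coalgebra.coassoc_apply, ← LinearMap.comp_apply,
    ← LinearMap.lTensor_comp]
  rfl

/-- Moves a multiplier from the right leg of `Δ(a)` to the left leg, at the price of replacing `a`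
by `q₂ a`. This is useful whenever `q₂ a` is controlled, as for an integral or an element of a left
ideal. -/
theorem mul_tmul_comul_eq_sum {ι : Type*} {q : A} (r : Coalgebra.Repr k q ι) (a : A) :
    1 ⊗ₜ[k] q * Coalgebra.comul (R := k) a =
      ∑ i ∈ r.index, antipode k (r.left i) ⊗ₜ[k] (1 : A) *
        Coalgebra.comul (R := k) (r.right i * a) := by
  rw [← sum_antipode_tmul_one_mul_comul r, Finset.sum_mul]
  simp only [Bialgebra.comul_mul, mul_assoc]

/-- If a left ideal `V` contains all left slices of `Δ(a)`, then it contains `∑ S(a₁) a₂ = ε(a)`. -/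
theorem sum_antipode_mul_sliceLeft_mem {V : Submodule k A} (hV : ∀ q, ∀ a ∈ V, q * a ∈ V) {a : A}
    (ha : ∀ φ : Module.Dual k A, sliceLeft φ (Coalgebra.comul (R := k) a) ∈ V) :
    algebraMap k A (Coalgebra.counit a) ∈ V := by
  obtain ⟨ι, I, m, φ, e⟩ := exists_eq_sum_tmul_sliceLeft (Coalgebra.comul (R := k) a)
  rw [← sum_antipode_mul_eq_algebraMap_counit (⟨I, m, _, e.symm⟩ : Coalgebra.Repr k a ι)]
  exact Submodule.sum_mem _ fun i _ ↦ hV _ _ (ha _)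

theorem eq_zero_of_sliceLeft_counit {a : A} (ha : ∀ φ : Module.Dual k A,
    Coalgebra.counit (R := k) (sliceLeft φ (Coalgebra.comul (R := k) a)) = 0) : a = 0 := by
  obtain ⟨ι, I, m, φ, e⟩ := exists_eq_sum_tmul_sliceLeft (Coalgebra.comul (R := k) a)
  have h := Coalgebra.lTensor_counit_comul (R := k) a
  rw [e, map_sum, Finset.sum_eq_zero fun i _ ↦ by rw [lTensor_tmul, ha, tmul_zero]] at h
  simpa using (congrArg (TensorProduct.rid k A) h).symm

theorem sliceLeft_one_tmul_mul (φ : Module.Dual k A) (q : A) (t : A ⊗[k] A) :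
    sliceLeft φ (1 ⊗ₜ[k] q * t) = q * sliceLeft φ t := by
  induction t with
  | zero => simp
  | tmul x y => simp
  | add x y hx hy => simp only [map_add, mul_add, hx, hy]

theorem sliceLeft_tmul_one_mul (φ : Module.Dual k A) (q : A) (t : A ⊗[k] A) :
    sliceLeft φ (q ⊗ₜ[k] 1 * t) = sliceLeft (φ ∘ₗ LinearMap.mulLeft k q) t := by
  induction t with
  | zero => simp
  | tmul x y => simp
  | add x y hx hy => simp only [map_add, mul_add, hx, hy]

/-- A Hopf algebra with a left integral of nonzero counit is finite-dimensional. -/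
theorem finite_of_integral {t : A} (ht : ∀ a, a * t = Coalgebra.counit (R := k) a • t)
    (h0 : Coalgebra.counit (R := k) t ≠ 0) : Module.Finite k A := by
  -- `V` is spanned by the right legs of `Δ(t)`. It is a left ideal because `(1 ⊗ q) Δ(t) = (S(q) ⊗
  -- 1) Δ(t)` for an integral `t`.
  set V : Submodule k A := Submodule.span k
    (Set.range fun φ : Module.Dual k A ↦ sliceLeft φ (Coalgebra.comul (R := k) t)) with hV
  have hmem : ∀ φ : Module.Dual k A, sliceLeft φ (Coalgebra.comul (R := k) t) ∈ V :=
    fun φ ↦ Submodule.subset_span ⟨φ, rfl⟩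
  have hmul : ∀ q, ∀ a ∈ V, q * a ∈ V := by
    intro q a ha
    induction ha using Submodule.span_induction with
    | mem x hx =>
      obtain ⟨φ, rfl⟩ := hx
      dsimp only
      rw [← sliceLeft_one_tmul_mul, mul_tmul_comul_eq_sum (Coalgebra.Repr.arbitrary k q), map_sum]
      refine Submodule.sum_mem _ fun i _ ↦ ?_
      rw [ht, map_smul, mul_smul_comm, map_smul, sliceLeft_tmul_one_mul]
      exact V.smul_mem _ (hmem _)
    | zero => simp
    | add x y _ _ hx hy => rw [mul_add]; exact V.add_mem hx hy
    | smul c x _ hx => rw [mul_smul_comm]; exact V.smul_mem _ hx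
  -- `V` contains `∑ S(t₁) t₂ = ε(t) 1`, and `ε(t)` is invertible.
  have hone : (1 : A) ∈ V := by
    have := V.smul_mem (Coalgebra.counit (R := k) t)⁻¹ (sum_antipode_mul_sliceLeft_mem hmul hmem)
    rwa [Algebra.algebraMap_eq_smul_one, smul_smul, inv_mul_cancel₀ h0, one_smul] at this
  -- Now `V = A`, while any expression of `Δ(t)` as a finite sum of tensors bounds `V` by the span
  -- of its right legs.
  let r := Coalgebra.Repr.arbitrary k t
  suffices h : (⊤ : Submodule k A) = Submodule.span k (r.right '' r.index) from
    ⟨h ▸ Submodule.fg_span (r.index.finite_toSet.image r.right)⟩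
  refine (eq_top_iff.2 fun a _ ↦ ?_).symm
  have ha := hmul a 1 hone
  rw [mul_one] at ha
  refine Submodule.span_le.2 ?_ ha
  rintro _ ⟨φ, rfl⟩
  dsimp only
  rw [← r.eq, map_sum]
  exact Submodule.sum_mem _ fun i hi ↦
    Submodule.smul_mem _ _ (Submodule.subset_span ⟨i, hi, rfl⟩)

/-- A Hopf algebra over a field that is semisimple as a ring is finite-dimensional. -/
theorem finite_of_isSemisimpleRing [IsSemisimpleRing A] : Module.Finite k A := by
  let I : Ideal A := RingHom.ker (Bialgebra.counitAlgHom k A)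
  obtain ⟨J, hJ⟩ := exists_isCompl I
  obtain ⟨x, hx, t, ht, hxt⟩ := Submodule.mem_sup.1
    (show (1 : A) ∈ I ⊔ J by rw [hJ.sup_eq_top]; trivial)
  have hx0 : Coalgebra.counit (R := k) x = 0 := hx
  refine finite_of_integral (k := k) (t := t) (fun a ↦ ?_) ?_
  -- The component `t` of `1` in a complement `J` of the augmentation ideal is an integral: `a t -
  -- ε(a) t` has counit zero and lies in `J`.
  · rw [← sub_eq_zero, ← Submodule.mem_bot A, ← hJ.inf_eq_bot]
    refine ⟨?_, ?_⟩
    · change Coalgebra.counit (R := k) _ = 0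
      simp
    · rw [← smul_one_mul]
      exact J.sub_mem (J.smul_mem a ht) (J.smul_mem _ ht)
  · have := congrArg (Coalgebra.counit (R := k)) hxt
    rw [map_add, hx0, zero_add, Bialgebra.counit_one] at this
    rw [this]
    exact one_ne_zero

/-- A Hopf algebra map onto a Hopf algebra with a nonzero integral is injective as soon as
its coinvariants are trivial. -/
theorem injective_of_coinvariants_trivial {B : Type w} [Ring B] [HopfAlgebra k B]
    (F : A →ₐc[k] B) (hF : Function.Surjective F)
    (hco : ∀ a : A, (F : A →ₗ[k] B).lTensor A (Coalgebra.comul a) = a ⊗ₜ 1 → ∃ c : k, a = c • 1)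
    {lam : Module.Dual k B} (hlam : lam ≠ 0) (hint : ∀ b, rightTranslate lam b = lam b • 1) :
    Function.Injective F := by
  set μ : Module.Dual k A := lam ∘ₗ (F : A →ₗ[k] B) with hμ
  have hFcomul : ∀ a : A, Coalgebra.comul (R := k) (F a) =
      TensorProduct.map (F : A →ₗ[k] B) (F : A →ₗ[k] B) (Coalgebra.comul a) :=
    fun a ↦ (CoalgHomClass.map_comp_comul_apply F a).symm
  have hF1 : ∀ a : A, F (rightTranslate μ a) = lam (F a) • 1 := by
    intro a
    rw [← hint, rightTranslate_apply, rightTranslate_apply, hFcomul]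
    generalize Coalgebra.comul (R := k) a = t
    induction t with
    | zero => simp
    | tmul x y => simp [hμ]
    | add x y hx hy => simp only [map_add, hx, hy]
  -- By coassociativity and `hF1`, `∑ a₁ μ(a₂)` is coinvariant, hence a scalar; the counit
  -- identifies this scalar as `μ a`.
  have hμint : ∀ a, rightTranslate μ a = μ a • 1 := by
    intro a
    obtain ⟨c, hc⟩ := hco (rightTranslate μ a) (by
      rw [comul_rightTranslate, rightTranslate_apply]
      generalize Coalgebra.comul (R := k) a = t
      induction t with
      | zero => simp
      | tmul x y =>
        rw [sliceRight_tmul, lTensor_tmul, lTensor_tmul, ← TensorProduct.smul_tmul',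
          ← TensorProduct.tmul_smul]
        exact congrArg _ (hF1 y)
      | add x y hx hy => simp only [map_add, hx, hy, add_tmul])
    have := counit_rightTranslate μ a
    rw [hc] at this ⊢
    simp only [map_smul, Bialgebra.counit_one, smul_eq_mul, mul_one] at this
    rw [this]
  -- The radical of the form `(q, a) ↦ μ(q a)`. It contains `ker F`, so it suffices that `W = 0`.
  let W : Submodule k A :=
    { carrier := {a | ∀ q, μ (q * a) = 0}
      add_mem' := fun ha hb q ↦ by rw [mul_add, map_add, ha, hb, add_zero]
      zero_mem' := fun q ↦ by simp
      smul_mem' := fun c a ha q ↦ by rw [mul_smul_comm, map_smul, ha, smul_zero] }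
  have hmul : ∀ q, ∀ a ∈ W, q * a ∈ W := fun q a ha q' ↦ by rw [← mul_assoc]; exact ha _
  -- Moving `q` across `Δ(a)` gives `∑ a₁ μ(q a₂) = ∑ S(q₁) μ(q₂ a)`, and each `μ(q₂ a)` is zero.
  have hslice : ∀ a ∈ W, ∀ φ : Module.Dual k A, sliceLeft φ (Coalgebra.comul (R := k) a) ∈ W := by
    intro a ha φ q
    have hcomm : ∀ t : A ⊗[k] A, μ (sliceLeft φ t) = φ (sliceRight μ t) := by
      intro t
      induction t with
      | zero => simp
      | tmul x y => simp [mul_comm]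
      | add x y hx hy => simp only [map_add, hx, hy]
    have hpull : ∀ (y : A) (t : A ⊗[k] A), sliceRight μ (y ⊗ₜ[k] 1 * t) = y * sliceRight μ t := by
      intro y t
      induction t with
      | zero => simp
      | tmul x y => simp
      | add x y hx hy => simp only [map_add, mul_add, hx, hy]
    rw [← sliceLeft_one_tmul_mul, hcomm, mul_tmul_comul_eq_sum (Coalgebra.Repr.arbitrary k q),
      map_sum, Finset.sum_eq_zero fun i _ ↦ ?_, map_zero]
    rw [hpull, ← rightTranslate_apply, hμint, ha, zero_smul, mul_zero]
  -- `W` contains `ε(a) 1`; if `ε(a) ≠ 0`, then `μ = 0`, and surjectivity of `F` gives `lam = 0`.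
  have hW : ∀ a ∈ W, Coalgebra.counit (R := k) a = 0 := by
    intro a ha
    have h1 := sum_antipode_mul_sliceLeft_mem hmul (hslice a ha)
    by_contra h0
    apply hlam
    ext b
    obtain ⟨q, rfl⟩ := hF b
    have h2 := h1 q
    rw [Algebra.algebraMap_eq_smul_one, mul_smul_comm, mul_one, map_smul, smul_eq_mul] at h2
    exact (mul_eq_zero.1 h2).resolve_left h0
  rw [injective_iff_map_eq_zero]
  intro a ha
  refine eq_zero_of_sliceLeft_counit (k := k) fun φ ↦ hW _ (hslice a (fun q ↦ ?_) φ)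
  simp [hμ, ha]

end HopfAlgebra

/-! ### Existence of an integral functional by traces -/

section PartialTrace

open TensorProduct LinearMap

variable {k : Type*} {M N V : Type*} [Field k] [AddCommGroup M] [Module k M] [AddCommGroup N]
  [Module k N] [AddCommGroup V] [Module k V] [FiniteDimensional k M] [FiniteDimensional k N]

/-- Partial trace: the trace of `m ⊗ n ↦ (θ m ⊗ id) (Ξ n)` can be computed in two steps. -/
theorem LinearMap.trace_tensorProduct_eq (T : M ⊗[k] N →ₗ[k] M ⊗[k] N) (θ : M →ₗ[k] V →ₗ[k] M)
    (Ξ : N →ₗ[k] V ⊗[k] N) (hT : ∀ m n, T (m ⊗ₜ n) = (θ m).rTensor N (Ξ n))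
    (τ : Module.Dual k V) (hτ : ∀ v, τ v = LinearMap.trace k M (θ.flip v)) :
    LinearMap.trace k (M ⊗[k] N) T = LinearMap.trace k N (sliceLeft τ ∘ₗ Ξ) := by
  classical
  let b := Module.finBasis k M
  let c := Module.finBasis k N
  rw [LinearMap.trace_eq_matrix_trace k (b.tensorProduct c), LinearMap.trace_eq_matrix_trace k c]
  simp only [Matrix.trace, Matrix.diag, LinearMap.toMatrix_apply, Fintype.sum_prod_type]
  rw [Finset.sum_comm]
  refine Finset.sum_congr rfl fun j _ ↦ ?_
  simp only [Module.Basis.tensorProduct_apply, hT, LinearMap.comp_apply]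
  generalize Ξ (c j) = t
  induction t with
  | zero => simp
  | tmul v n =>
    simp only [rTensor_tmul, Module.Basis.tensorProduct_repr_tmul_apply, sliceLeft_tmul, hτ,
      LinearMap.trace_eq_matrix_trace k b, Matrix.trace, Matrix.diag, LinearMap.toMatrix_apply,
      map_smul, Finsupp.smul_apply, LinearMap.flip_apply, smul_eq_mul, Finset.sum_mul]
    simp [mul_comm]
  | add x y hx hy => simp only [map_add, Finsupp.add_apply, Finset.sum_add_distrib, hx, hy]

end PartialTrace

namespace HopfAlgebra

open TensorProduct LinearMap

variable {k : Type u} {A : Type v} [Field k] [Ring A] [HopfAlgebra k A]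

/-- The functional `x ↦ tr (a ↦ ∑ (x S²(a))₁ φ((x S²(a))₂))`, an integral on `A`. -/
noncomputable def traceIntegral (φ : Module.Dual k A) : Module.Dual k A where
  toFun x := LinearMap.trace k A
    (rightTranslate φ ∘ₗ LinearMap.mulLeft k x ∘ₗ antipode k ∘ₗ antipode k)
  map_add' x y := by
    rw [← map_add]
    congr 1
    ext a
    simp [add_mul]
  map_smul' c x := by
    rw [RingHom.id_apply, ← map_smul]
    congr 1
    ext a
    simp

theorem traceIntegral_apply (φ : Module.Dual k A) (x : A) :
    traceIntegral φ x = LinearMap.trace k A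
      (rightTranslate φ ∘ₗ LinearMap.mulLeft k x ∘ₗ antipode k ∘ₗ antipode k) := rfl

/-- A form of coassociativity. With `y = x S²(g)` and `c = S(a)` it separates the dependence on `a`
from that on `g`, as the partial trace formula requires. -/
theorem comul_sliceLeft_lTensor_rightTranslate (φ ψ : Module.Dual k A) (c y : A) :
    Coalgebra.comul (R := k) (sliceLeft ψ ((rightTranslate φ).lTensor A
        (Coalgebra.comul (R := k) y * c ⊗ₜ[k] 1))) =
      (sliceLeft ψ ∘ₗ LinearMap.mulRight k (c ⊗ₜ[k] (1 : A))).rTensor A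
        (TensorProduct.map Coalgebra.comul (rightTranslate φ) (Coalgebra.comul (R := k) y)) := by
  let K : A ⊗[k] (A ⊗[k] A) →ₗ[k] A ⊗[k] A :=
    (rightTranslate φ).lTensor A ∘ₗ sliceLeft (ψ ∘ₗ LinearMap.mulRight k c)
  have h1 : ∀ t : A ⊗[k] A, Coalgebra.comul (R := k) (sliceLeft ψ ((rightTranslate φ).lTensor A
        (t * c ⊗ₜ[k] 1))) = K (Coalgebra.comul.lTensor A t) := by
    intro t
    induction t with
    | zero => simp
    | tmul p q => simp [K, comul_rightTranslate]
    | add x y hx hy => simp only [map_add, add_mul, hx, hy]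
  have h2 : ∀ (d : A ⊗[k] A) (q : A),
      (sliceLeft ψ ∘ₗ LinearMap.mulRight k (c ⊗ₜ[k] (1 : A))) d ⊗ₜ[k] rightTranslate φ q =
        K (TensorProduct.assoc k A A A (d ⊗ₜ q)) := by
    intro d q
    induction d with
    | zero => simp
    | tmul a b => simp [K, smul_tmul']
    | add x y hx hy => simp only [map_add, add_tmul, hx, hy]
  have h3 : ∀ t : A ⊗[k] A, (sliceLeft ψ ∘ₗ LinearMap.mulRight k (c ⊗ₜ[k] (1 : A))).rTensor A
        (TensorProduct.map Coalgebra.comul (rightTranslate φ) t) =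
      K (TensorProduct.assoc k A A A (Coalgebra.comul.rTensor A t)) := by
    intro t
    induction t with
    | zero => simp
    | tmul p q => exact h2 _ _
    | add x y hx hy => simp only [map_add, hx, hy]
  rw [h1, h3, Coalgebra.coassoc_apply]

theorem sliceLeft_map_comul (φ ψ : Module.Dual k A) (y : A) :
    sliceLeft (ψ ∘ₗ LinearMap.mul' k A ∘ₗ (antipode k).lTensor A)
      (TensorProduct.map Coalgebra.comul (rightTranslate φ) (Coalgebra.comul (R := k) y)) =
      ψ 1 • rightTranslate φ y := by
  have h : ∀ t : A ⊗[k] A, sliceLeft (ψ ∘ₗ LinearMap.mul' k A ∘ₗ (antipode k).lTensor A)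
      (TensorProduct.map Coalgebra.comul (rightTranslate φ) t) =
      ψ 1 • rightTranslate φ (TensorProduct.lid k A (Coalgebra.counit.rTensor A t)) := by
    intro t
    induction t with
    | zero => simp
    | tmul p q =>
      simp [Algebra.algebraMap_eq_smul_one, smul_smul, mul_comm]
    | add x y hx hy => simp only [map_add, smul_add, hx, hy]
  rw [h, Coalgebra.rTensor_counit_comul]
  simp

/-- After pairing with `ψ`, the left side is the trace of a composite `Γ ∘ Δ` on `A`. This equals
the trace of `Δ ∘ Γ` on `A ⊗ A`; there a partial trace over the first factor produces `∑ p₁ S(p₂) =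
ε(p)` and leaves `ψ(1)` times the original trace. -/
theorem rightTranslate_traceIntegral [FiniteDimensional k A] (φ : Module.Dual k A) (x : A) :
    rightTranslate (traceIntegral φ) x = traceIntegral φ x • 1 := by
  rw [← sub_eq_zero, ← Module.forall_dual_apply_eq_zero_iff k]
  intro ψ
  rw [map_sub, map_smul, sub_eq_zero, smul_eq_mul]
  let G : A ⊗[k] A →ₗ[k] A ⊗[k] A := LinearMap.mul' k (A ⊗[k] A) ∘ₗ
    TensorProduct.map (Coalgebra.comul ∘ₗ LinearMap.mulLeft k x ∘ₗ antipode k ∘ₗ antipode k)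
      ((Algebra.TensorProduct.includeLeft (R := k) (S := k) (A := A) (B := A)).toLinearMap ∘ₗ
        antipode k) ∘ₗ (TensorProduct.comm k A A).toLinearMap
  let Γ : A ⊗[k] A →ₗ[k] A := sliceLeft ψ ∘ₗ (rightTranslate φ).lTensor A ∘ₗ G
  have hG : ∀ a g, G (a ⊗ₜ g) = Coalgebra.comul (R := k) (x * antipode k (antipode k g)) *
      antipode k a ⊗ₜ[k] 1 := fun a g ↦ rfl
  have hGcomul : ∀ a, G (Coalgebra.comul (R := k) a) =
      Coalgebra.comul (R := k) x * 1 ⊗ₜ antipode k (antipode k a) := by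
    intro a
    let r := Coalgebra.Repr.arbitrary k a
    rw [← sum_comul_antipode_antipode_mul_tmul_one r, ← r.eq, map_sum, Finset.mul_sum]
    exact Finset.sum_congr rfl fun i _ ↦ by rw [hG, Bialgebra.comul_mul, mul_assoc]
  have h1 : ψ (rightTranslate (traceIntegral φ) x) =
      LinearMap.trace k A (Γ ∘ₗ Coalgebra.comul) := by
    have e : ∀ t : A ⊗[k] A, ψ (sliceRight (traceIntegral φ) t) = LinearMap.trace k A
        (sliceLeft ψ ∘ₗ (rightTranslate φ).lTensor A ∘ₗ LinearMap.mulLeft k t ∘ₗ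
          (Algebra.TensorProduct.includeRight (R := k) (A := A) (B := A)).toLinearMap ∘ₗ
            antipode k ∘ₗ antipode k) := by
      intro t
      induction t with
      | zero => simp
      | tmul p q =>
        rw [sliceRight_tmul, map_smul, smul_eq_mul, traceIntegral_apply, mul_comm, ← smul_eq_mul,
          ← map_smul]
        congr 1
        ext a
        simp
      | add y z hy hz =>
        rw [map_add, map_add, hy, hz, ← map_add]
        congr 1
        ext a
        simp [add_mul]
    rw [rightTranslate_apply, e]
    congr 1
    ext a
    simp [Γ, hGcomul]
  let θ : A →ₗ[k] A ⊗[k] A →ₗ[k] A := LinearMap.mk₂ k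
    (fun a v ↦ sliceLeft ψ (v * antipode k a ⊗ₜ[k] 1))
    (fun a b v ↦ by rw [map_add, add_tmul, mul_add, map_add])
    (fun c a v ↦ by rw [map_smul, ← smul_tmul', mul_smul_comm, map_smul])
    (fun a v w ↦ by rw [add_mul, map_add]) (fun c a v ↦ by rw [smul_mul_assoc, map_smul])
  rw [h1, LinearMap.trace_comp_comm', LinearMap.trace_tensorProduct_eq _ θ
    (TensorProduct.map Coalgebra.comul (rightTranslate φ) ∘ₗ Coalgebra.comul ∘ₗ
      LinearMap.mulLeft k x ∘ₗ antipode k ∘ₗ antipode k) ?_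
    (ψ ∘ₗ LinearMap.mul' k A ∘ₗ (antipode k).lTensor A) ?_]
  · rw [traceIntegral_apply, mul_comm, ← smul_eq_mul, ← map_smul]
    congr 1
    ext a
    exact sliceLeft_map_comul φ ψ _
  · intro a g
    exact comul_sliceLeft_lTensor_rightTranslate φ ψ _ _
  -- For `v = p ⊗ q` the operator `a ↦ ψ(p S(a)) q` has rank at most one and trace `ψ(p S(q))`.
  · intro v
    induction v with
    | zero => simp
    | tmul p q =>
      have : θ.flip (p ⊗ₜ q) =
          (ψ ∘ₗ LinearMap.mulLeft k p ∘ₗ antipode k).smulRight q := by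
        ext a
        simp [θ]
      rw [this, LinearMap.trace_smulRight]
      simp
    | add y z hy hz => rw [map_add, hy, hz, map_add, map_add]

/-- The operator `a ↦ S(∑ S(a₁) a₂) = ε(a) 1` has trace `1`. Cycling the trace onto `A ⊗ A` and
expanding in a basis `b` writes this `1` as the sum over `j` of `traceIntegral (b.coord j) (S(b
j))`, so these functionals cannot all vanish. -/
theorem exists_traceIntegral_ne_zero [FiniteDimensional k A] :
    ∃ φ : Module.Dual k A, traceIntegral φ ≠ 0 := by
  classical
  by_contra! h
  let F : A ⊗[k] A →ₗ[k] A := antipode k ∘ₗ LinearMap.mul' k A ∘ₗ (antipode k).rTensor A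
  have h1 : LinearMap.trace k A (F ∘ₗ Coalgebra.comul) = 1 := by
    have : F ∘ₗ Coalgebra.comul = (Coalgebra.counit (R := k) (A := A)).smulRight 1 := by
      ext a
      simp [F, Algebra.algebraMap_eq_smul_one]
    rw [this, LinearMap.trace_smulRight, Bialgebra.counit_one]
  let b := Module.finBasis k A
  have hb : ∀ (t : A ⊗[k] A) i j,
      (b.tensorProduct b).repr t (i, j) = b.coord i (sliceRight (b.coord j) t) := by
    intro t i j
    induction t with
    | zero => simp
    | tmul p q => simp
    | add y z hy hz => simp only [map_add, Finsupp.add_apply, hy, hz]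
  rw [LinearMap.trace_comp_comm', LinearMap.trace_eq_matrix_trace k (b.tensorProduct b)] at h1
  simp only [Matrix.trace, Matrix.diag, LinearMap.toMatrix_apply, Fintype.sum_prod_type, hb] at h1
  rw [Finset.sum_comm, Finset.sum_eq_zero fun j _ ↦ ?_] at h1
  · exact zero_ne_one h1
  · have := LinearMap.congr_fun (h (b.coord j)) (antipode k (b j))
    rw [traceIntegral_apply, LinearMap.trace_eq_matrix_trace k b] at this
    simpa [Matrix.trace, Matrix.diag, LinearMap.toMatrix_apply, F, antipode_mul_antidistrib,
      rightTranslate_apply] using this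

/-- A finite-dimensional Hopf algebra has a nonzero integral functional. -/
theorem exists_integral_functional [FiniteDimensional k A] :
    ∃ lam : Module.Dual k A, lam ≠ 0 ∧ ∀ a, rightTranslate lam a = lam a • 1 := by
  obtain ⟨φ, hφ⟩ := exists_traceIntegral_ne_zero (k := k) (A := A)
  exact ⟨_, hφ, rightTranslate_traceIntegral φ⟩

end HopfAlgebra

/-! ### Multiplication maps of commuting Hopf algebras and their coinvariants -/

namespace HopfAlgebra

open TensorProduct LinearMap WithConv

variable {k : Type u} {A : Type v} [Field k] [Ring A] [HopfAlgebra k A]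
variable {B C : Type*} [Ring B] [HopfAlgebra k B] [Ring C] [HopfAlgebra k C]

/-- The Hopf algebra map `b ⊗ c ↦ f b * g c` for `f`, `g` with commuting images. -/
noncomputable def tensorLift (f : B →ₐc[k] A) (g : C →ₐc[k] A)
    (hfg : ∀ b c, Commute (f b) (g c)) : B ⊗[k] C →ₐc[k] A :=
  have h (b : B) (c : C) : Algebra.TensorProduct.lift (f : B →ₐ[k] A) (g : C →ₐ[k] A) hfg
      (b ⊗ₜ c) = f b * g c := rfl
  BialgHom.ofAlgHom (Algebra.TensorProduct.lift (f : B →ₐ[k] A) (g : C →ₐ[k] A) hfg)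
    (by
      generalize Algebra.TensorProduct.lift (f : B →ₐ[k] A) (g : C →ₐ[k] A) hfg = L at h
      ext b <;> simp [h])
    (by
      generalize Algebra.TensorProduct.lift (f : B →ₐ[k] A) (g : C →ₐ[k] A) hfg = L at h
      ext b
      · have hb : L (b ⊗ₜ 1) = f b := by rw [h, map_one, mul_one]
        simp only [AlgHom.comp_apply, Algebra.TensorProduct.includeLeft_apply,
          Bialgebra.comulAlgHom_apply, hb, ← CoalgHomClass.map_comp_comul_apply f,
          TensorProduct.comul_tmul, Bialgebra.comul_one, Algebra.TensorProduct.one_def]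
        generalize Coalgebra.comul (R := k) b = t
        induction t with
        | zero => simp
        | tmul x y => simp [h]
        | add x y hx hy => simp only [map_add, add_tmul, hx, hy]
      · have hb : L (1 ⊗ₜ b) = g b := by rw [h, map_one, one_mul]
        simp only [AlgHom.comp_apply, AlgHom.restrictScalars_apply,
          Algebra.TensorProduct.includeRight_apply,
          Bialgebra.comulAlgHom_apply, hb, ← CoalgHomClass.map_comp_comul_apply g,
          TensorProduct.comul_tmul, Bialgebra.comul_one, Algebra.TensorProduct.one_def]
        generalize Coalgebra.comul (R := k) b = t
        induction t with
        | zero => simp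
        | tmul x y => simp [h]
        | add x y hx hy => simp only [map_add, tmul_add, hx, hy])

@[simp] theorem tensorLift_tmul (f : B →ₐc[k] A) (g : C →ₐc[k] A)
    (hfg : ∀ b c, Commute (f b) (g c)) (b : B) (c : C) :
    tensorLift f g hfg (b ⊗ₜ c) = f b * g c := rfl

/-- Coinvariance equates an element of the image of `f` with the image under `g` of an arbitrary
left slice of `x`. Such an element is a scalar, so `x` lies in `B ⊗ 1`, where injectivity of `f`
finishes. -/
theorem eq_smul_one_of_coinvariant (f : B →ₐc[k] A) (g : C →ₐc[k] A)
    (hfg : ∀ b c, Commute (f b) (g c)) (hf : Function.Injective f) (hg : Function.Injective g)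
    (hinf : ∀ b c, f b = g c → ∃ r : k, f b = r • 1) (x : B ⊗[k] C)
    (hx : (tensorLift f g hfg : B ⊗[k] C →ₗ[k] A).lTensor _ (Coalgebra.comul x) = x ⊗ₜ 1) :
    ∃ r : k, x = r • 1 := by
  let p : B ⊗[k] C →ₗ[k] B := sliceRight Coalgebra.counit
  have hslice : ∀ ψ : Module.Dual k B, sliceLeft ψ x = ψ (p x) • 1 := by
    intro ψ
    -- `N(b) = ∑ ψ(b₁) S(b₂)` is chosen so that `∑ N(b₁) b₂ = ψ(b) 1`. Thus `Ξ` cancels the factor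
    -- from `B` and leaves only the `C` leg.
    let N : WithConv (B →ₗ[k] B) := toConv (Algebra.linearMap k B ∘ₗ ψ) * toConv (antipode k)
    have hN : N * toConv LinearMap.id = toConv (Algebra.linearMap k B ∘ₗ ψ) := by
      rw [mul_assoc, antipode_mul_id, mul_one]
    let Ξ : (B ⊗[k] C) ⊗[k] A →ₗ[k] A :=
      LinearMap.mul' k A ∘ₗ ((f : B →ₗ[k] A) ∘ₗ N.ofConv ∘ₗ p).rTensor A
    have h1 : ∀ y : B ⊗[k] C, Ξ ((tensorLift f g hfg : B ⊗[k] C →ₗ[k] A).lTensor _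
        (Coalgebra.comul y)) = g (sliceLeft ψ y) := by
      intro y
      induction y with
      | zero => simp
      | tmul b c =>
        let r := Coalgebra.Repr.arbitrary k b
        let s := Coalgebra.Repr.arbitrary k c
        have e1 : ∑ i ∈ r.index, f (N.ofConv (r.left i)) * f (r.right i) = ψ b • 1 := by
          have := LinearMap.congr_fun (congrArg ofConv hN) b
          rw [← toConv_ofConv (N * _), r.convMul_apply] at this
          have := congrArg f this
          simpa [Algebra.algebraMap_eq_smul_one] using this
        have e2 : ∑ j ∈ s.index, Coalgebra.counit (R := k) (s.left j) • g (s.right j) = g c := by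
          simpa using congrArg g (Coalgebra.sum_counit_smul s)
        rw [← (r.tmul s).eq, map_sum, map_sum]
        simp only [Coalgebra.Repr.tmul_index, Coalgebra.Repr.tmul_left, Coalgebra.Repr.tmul_right,
          Finset.sum_product, lTensor_tmul, sliceLeft_tmul, map_smul]
        calc _ = ∑ i ∈ r.index, ∑ j ∈ s.index, (f (N.ofConv (r.left i)) * f (r.right i)) *
              (Coalgebra.counit (R := k) (s.left j) • g (s.right j)) := by
              refine Finset.sum_congr rfl fun i _ ↦ Finset.sum_congr rfl fun j _ ↦ ?_
              simp [Ξ, p, mul_assoc]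
          _ = _ := by
              simp only [← Finset.mul_sum, e2, ← Finset.sum_mul, e1, smul_mul_assoc, one_mul]
      | add y z hy hz => simp only [map_add, hy, hz]
    have h2 : f (N.ofConv (p x)) = g (sliceLeft ψ x) := by
      rw [← h1, hx]
      simp [Ξ]
    obtain ⟨r, hr⟩ := hinf _ _ h2
    have h3 : sliceLeft ψ x = r • 1 := hg (by rw [← h2, hr, map_smul, map_one])
    have h4 : ∀ y : B ⊗[k] C, Coalgebra.counit (R := k) (sliceLeft ψ y) = ψ (p y) := by
      intro y
      induction y with
      | zero => simp
      | tmul b c => simp [p, mul_comm]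
      | add y z hy hz => simp only [map_add, hy, hz]
    rw [← h4, h3, map_smul, Bialgebra.counit_one, smul_eq_mul, mul_one]
  have hxp : x = p x ⊗ₜ 1 := ext_sliceLeft fun ψ ↦ by rw [hslice, sliceLeft_tmul]
  -- Apply `ε ⊗ id` to the coinvariance equation.
  have hF : tensorLift f g hfg x = Coalgebra.counit (R := k) x • 1 := by
    have h5 := congrArg (fun t ↦ TensorProduct.lid k A (Coalgebra.counit.rTensor A t)) hx
    have h6 : ∀ t : (B ⊗[k] C) ⊗[k] (B ⊗[k] C), TensorProduct.lid k A
        (Coalgebra.counit.rTensor A ((tensorLift f g hfg : B ⊗[k] C →ₗ[k] A).lTensor _ t)) =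
        tensorLift f g hfg (TensorProduct.lid k _ (Coalgebra.counit.rTensor _ t)) := by
      intro t
      induction t with
      | zero => simp
      | tmul y z => simp
      | add y z hy hz => simp only [map_add, hy, hz]
    rw [h6, Coalgebra.rTensor_counit_comul] at h5
    simpa using h5
  refine ⟨Coalgebra.counit (R := k) x, ?_⟩
  have h7 : p x = Coalgebra.counit (R := k) x • 1 := hf (by
    rw [hxp, tensorLift_tmul, map_one, mul_one, ← hxp] at hF
    rw [hF, map_smul, map_one])
  rw [Algebra.TensorProduct.one_def, smul_tmul', ← h7, ← hxp]

end HopfAlgebra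

/-! ### Injectivity of multiplication onto a Hopf subalgebra -/

namespace HopfSubalgebra

variable {k : Type u} {H : Type v} [Field k] [Ring H] [HopfAlgebra k H]

/-- The inclusion of a Hopf subalgebra, as a map of Hopf algebras. -/
noncomputable def valHom (A : HopfSubalgebra k H) : A.toSubalgebra →ₐc[k] H :=
  BialgHom.ofAlgHom A.toSubalgebra.val rfl A.map_comp_comulRestrict

/-- Restriction of the codomain of a map of Hopf algebras to a Hopf subalgebra. -/
noncomputable def codRestrict {P : Type w} [Ring P] [HopfAlgebra k P] (F : P →ₐc[k] H)
    (D : HopfSubalgebra k H) (hF : ∀ x, F x ∈ D.toSubalgebra) : P →ₐc[k] D.toSubalgebra :=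
  BialgHom.ofAlgHom ((F : P →ₐ[k] H).codRestrict D.toSubalgebra hF)
    (by
      ext x
      exact CoalgHomClass.counit_comp_apply F x)
    (by
      rw [← AlgHom.cancel_left D.map_val_injective, ← AlgHom.comp_assoc,
        ← Algebra.TensorProduct.map_comp, ← AlgHom.comp_assoc]
      erw [D.map_comp_comulRestrict]
      ext x
      exact CoalgHomClass.map_comp_comul_apply F x)

@[simp] theorem coe_codRestrict {P : Type w} [Ring P] [HopfAlgebra k P] (F : P →ₐc[k] H)
    (D : HopfSubalgebra k H) (hF : ∀ x, F x ∈ D.toSubalgebra) (x : P) :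
    (codRestrict F D hF x : H) = F x := rfl

open HopfAlgebra in
theorem injective_tensorLift [FiniteDimensional k H] {B C : Type*} [Ring B] [HopfAlgebra k B]
    [Ring C] [HopfAlgebra k C] (f : B →ₐc[k] H) (g : C →ₐc[k] H)
    (hfg : ∀ b c, Commute (f b) (g c)) (hf : Function.Injective f) (hg : Function.Injective g)
    (hinf : ∀ b c, f b = g c → ∃ r : k, f b = r • 1) (D : HopfSubalgebra k H)
    (hD : (tensorLift f g hfg : B ⊗[k] C →ₐ[k] H).range = D.toSubalgebra) :
    Function.Injective (tensorLift f g hfg) := by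
  have hmem : ∀ x, tensorLift f g hfg x ∈ D.toSubalgebra := fun x ↦ hD ▸ ⟨x, rfl⟩
  -- The integral is taken on the image `D`, since the criterion needs a surjective map.
  obtain ⟨lam, h0, hint⟩ := exists_integral_functional (k := k) (A := D.toSubalgebra)
  have := injective_of_coinvariants_trivial (codRestrict _ D hmem)
    (by
      rintro ⟨y, hy⟩
      rw [← hD] at hy
      obtain ⟨x, rfl⟩ := hy
      exact ⟨x, rfl⟩)
    (fun x hx ↦ eq_smul_one_of_coinvariant f g hfg hf hg hinf x (by
      have := congrArg (D.toSubalgebra.val.toLinearMap.lTensor (B ⊗[k] C)) hx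
      rwa [← LinearMap.comp_apply, ← LinearMap.lTensor_comp] at this)) h0 hint
  intro x y hxy
  exact this (Subtype.ext hxy)

end HopfSubalgebra

/-! ### Intersections, adjoint actions and commutation of normal Hopf subalgebras -/

namespace HopfSubalgebra

open TensorProduct LinearMap WithConv HopfAlgebra

variable {k : Type u} {H : Type v} [Field k] [Ring H] [HopfAlgebra k H]

theorem sliceRight_eq_sliceLeft_comm {M N : Type*} [AddCommGroup M] [Module k M] [AddCommGroup N]
    [Module k N] (φ : Module.Dual k N) (t : M ⊗[k] N) :
    sliceRight φ t = sliceLeft φ (TensorProduct.comm k M N t) := by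
  induction t with
  | zero => simp
  | tmul x y => simp
  | add x y hx hy => simp only [map_add, hx, hy]

/-- Membership in `A ⊗ A` can be tested on slices. -/
theorem mem_range_map_val_iff (A : Subalgebra k H) (t : H ⊗[k] H) :
    t ∈ (Algebra.TensorProduct.map A.val A.val).range ↔
      ∀ φ : Module.Dual k H, sliceLeft φ t ∈ A ∧ sliceRight φ t ∈ A := by
  constructor
  · rintro ⟨s, rfl⟩ φ
    induction s with
    | zero => simp [A.zero_mem]
    | tmul x y => exact ⟨A.smul_mem y.2 _, A.smul_mem x.2 _⟩
    | add x y hx hy =>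
      simp only [map_add] at hx hy ⊢
      exact ⟨add_mem hx.1 hy.1, add_mem hx.2 hy.2⟩
  · intro h
    obtain ⟨ι, I, m, φ, e⟩ := exists_eq_sum_tmul_sliceLeft t
    -- Left slices in `A` put `t` in `H ⊗ A`. Slicing the other leg, with functionals on `A`
    -- extended to `H`, then puts it in `A ⊗ A`.
    let s : A ⊗[k] H := TensorProduct.comm k H A
      (∑ i ∈ I, m i ⊗ₜ ⟨sliceLeft (φ i) t, (h (φ i)).1⟩)
    have hs : A.val.toLinearMap.rTensor H s = TensorProduct.comm k H H t := by
      conv_rhs => rw [e]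
      simp [s]
    obtain ⟨κ, J, n, ψ, e'⟩ := exists_eq_sum_tmul_sliceLeft s
    have hslice : ∀ ψ : Module.Dual k A, sliceLeft ψ s ∈ A := by
      intro ψ
      obtain ⟨ψ', hψ'⟩ := LinearMap.exists_extend (p := Subalgebra.toSubmodule A) ψ
      have h1 : ∀ s : A ⊗[k] H, sliceLeft ψ s = sliceLeft ψ' (A.val.toLinearMap.rTensor H s) := by
        intro s
        induction s with
        | zero => simp
        | tmul x y =>
          have : ψ x = ψ' x := (LinearMap.congr_fun hψ' x).symm
          simp [this]
        | add x y hx hy => simp only [map_add, hx, hy]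
      rw [h1, hs, ← sliceRight_eq_sliceLeft_comm]
      exact (h ψ').2
    refine ⟨TensorProduct.comm k A A (∑ j ∈ J, n j ⊗ₜ ⟨_, hslice (ψ j)⟩), ?_⟩
    apply (TensorProduct.comm k H H).injective
    rw [← hs]
    conv_rhs => rw [e']
    simp

/-- The intersection of two Hopf subalgebras. -/
def inter (A B : HopfSubalgebra k H) : HopfSubalgebra k H where
  toSubalgebra := A.toSubalgebra ⊓ B.toSubalgebra
  comul_mem' a ha := (mem_range_map_val_iff _ _).2 fun φ ↦
    ⟨⟨((mem_range_map_val_iff _ _).1 (A.comul_mem' a ha.1) φ).1,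
      ((mem_range_map_val_iff _ _).1 (B.comul_mem' a ha.2) φ).1⟩,
     ⟨((mem_range_map_val_iff _ _).1 (A.comul_mem' a ha.1) φ).2,
      ((mem_range_map_val_iff _ _).1 (B.comul_mem' a ha.2) φ).2⟩⟩
  antipode_mem' a ha := ⟨A.antipode_mem' a ha.1, B.antipode_mem' a ha.2⟩

theorem IsNormal.inter {A B : HopfSubalgebra k H} (hA : A.IsNormal) (hB : B.IsNormal) :
    (A.inter B).IsNormal := fun h a ha ↦
  ⟨⟨(hA h a ha.1).1, (hB h a ha.2).1⟩, ⟨(hA h a ha.1).2, (hB h a ha.2).2⟩⟩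

theorem leftAdjoint_apply {ι : Type*} {h : H} (r : Coalgebra.Repr k h ι) (a : H) :
    leftAdjoint (k := k) a h = ∑ i ∈ r.index, r.left i * a * antipode k (r.right i) := by
  simp [leftAdjoint, ← r.eq]

theorem rightAdjoint_apply {ι : Type*} {h : H} (r : Coalgebra.Repr k h ι) (a : H) :
    rightAdjoint (k := k) a h = ∑ i ∈ r.index, antipode k (r.left i) * a * r.right i := by
  simp [rightAdjoint, ← r.eq]

/-- The element `h ↦ ε(h) a` of the convolution algebra. -/
noncomputable def convConst (k : Type u) {H : Type v} [Field k] [Ring H] [HopfAlgebra k H]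
    (a : H) : WithConv (H →ₗ[k] H) :=
  toConv (LinearMap.toSpanSingleton k H a ∘ₗ Coalgebra.counit)

theorem convConst_mul (a b : H) : convConst k a * convConst k b = convConst k (a * b) := by
  ext h
  let r := Coalgebra.Repr.arbitrary k h
  have := congrArg (Coalgebra.counit (R := k)) (Coalgebra.sum_counit_smul r)
  simp only [map_sum, map_smul, smul_eq_mul] at this
  rw [r.convMul_apply]
  conv_rhs => rw [convConst, WithConv.ofConv_toConv, LinearMap.comp_apply, ← this]
  simp [convConst, mul_smul, smul_comm (Coalgebra.counit (R := k) (r.left _))]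

theorem sum_counit_smul_left {ι : Type*} {h : H} (r : Coalgebra.Repr k h ι) :
    ∑ i ∈ r.index, Coalgebra.counit (R := k) (r.right i) • r.left i = h := by
  have := congrArg (TensorProduct.rid k H) (Coalgebra.sum_tmul_counit_eq r)
  rw [map_sum] at this
  simpa only [TensorProduct.rid_tmul, one_smul] using this

theorem id_convMul_convConst (a : H) :
    toConv LinearMap.id * convConst k a = toConv (LinearMap.mulRight k a) := by
  ext h
  let r := Coalgebra.Repr.arbitrary k h
  rw [r.convMul_apply]
  conv_rhs => rw [← sum_counit_smul_left r]
  simp [convConst]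

/-- The adjoint action is conjugation of a constant by the convolution unit `id`, whose inverse is
`S`; multiplicativity in `a` is then immediate. -/
theorem toConv_leftAdjoint (a : H) : toConv (leftAdjoint (k := k) a) =
    toConv LinearMap.id * convConst k a * toConv (antipode k) := by
  rw [id_convMul_convConst]
  rfl

theorem toConv_rightAdjoint (a : H) : toConv (rightAdjoint (k := k) a) =
    toConv (antipode k) * convConst k a * toConv LinearMap.id := by
  have : toConv (antipode k) * convConst k a =
      toConv (LinearMap.mulRight k a ∘ₗ antipode k) := by
    ext h
    let r := Coalgebra.Repr.arbitrary k h
    rw [r.convMul_apply]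
    conv_rhs => rw [← sum_counit_smul_left r]
    simp [convConst]
  rw [this]
  rfl

theorem toConv_leftAdjoint_mul (a b : H) : toConv (leftAdjoint (k := k) (a * b)) =
    toConv (leftAdjoint (k := k) a) * toConv (leftAdjoint (k := k) b) := by
  simp only [toConv_leftAdjoint, ← convConst_mul, mul_assoc]
  rw [← mul_assoc (toConv (antipode k)) (toConv LinearMap.id), antipode_mul_id, one_mul]

theorem toConv_rightAdjoint_mul (a b : H) : toConv (rightAdjoint (k := k) (a * b)) =
    toConv (rightAdjoint (k := k) a) * toConv (rightAdjoint (k := k) b) := by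
  simp only [toConv_rightAdjoint, ← convConst_mul, mul_assoc]
  rw [← mul_assoc (toConv LinearMap.id) (toConv (antipode k)), id_mul_antipode, one_mul]

theorem leftAdjoint_mul {ι : Type*} {h : H} (r : Coalgebra.Repr k h ι) (a b : H) :
    leftAdjoint (k := k) (a * b) h =
      ∑ i ∈ r.index, leftAdjoint (k := k) a (r.left i) * leftAdjoint (k := k) b (r.right i) := by
  have := LinearMap.congr_fun (congrArg ofConv (toConv_leftAdjoint_mul (k := k) a b)) h
  exact this.trans (r.convMul_apply _ _)

theorem rightAdjoint_mul {ι : Type*} {h : H} (r : Coalgebra.Repr k h ι) (a b : H) :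
    rightAdjoint (k := k) (a * b) h =
      ∑ i ∈ r.index, rightAdjoint (k := k) a (r.left i) * rightAdjoint (k := k) b (r.right i) := by
  have := LinearMap.congr_fun (congrArg ofConv (toConv_rightAdjoint_mul (k := k) a b)) h
  exact this.trans (r.convMul_apply _ _)

theorem leftAdjoint_algebraMap (c : k) (h : H) :
    leftAdjoint (k := k) (algebraMap k H c) h = algebraMap k H (c * Coalgebra.counit h) := by
  let r := Coalgebra.Repr.arbitrary k h
  rw [leftAdjoint_apply r, map_mul, ← sum_mul_antipode_eq_algebraMap_counit r, Finset.mul_sum]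
  exact Finset.sum_congr rfl fun i _ ↦ by rw [← Algebra.commutes c (r.left i), mul_assoc]

theorem rightAdjoint_algebraMap (c : k) (h : H) :
    rightAdjoint (k := k) (algebraMap k H c) h = algebraMap k H (c * Coalgebra.counit h) := by
  let r := Coalgebra.Repr.arbitrary k h
  rw [rightAdjoint_apply r, map_mul, ← sum_antipode_mul_eq_algebraMap_counit r, Finset.mul_sum]
  exact Finset.sum_congr rfl fun i _ ↦ by
    rw [← Algebra.commutes c (antipode k (r.left i)), mul_assoc]

theorem leftAdjoint_add (a b h : H) : leftAdjoint (k := k) (a + b) h =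
    leftAdjoint (k := k) a h + leftAdjoint (k := k) b h := by
  simp only [leftAdjoint_apply (Coalgebra.Repr.arbitrary k h), mul_add, add_mul,
    Finset.sum_add_distrib]

theorem rightAdjoint_add (a b h : H) : rightAdjoint (k := k) (a + b) h =
    rightAdjoint (k := k) a h + rightAdjoint (k := k) b h := by
  simp only [rightAdjoint_apply (Coalgebra.Repr.arbitrary k h), mul_add, add_mul,
    Finset.sum_add_distrib]

theorem IsNormal.generated {T : Set (HopfSubalgebra k H)} (hT : ∀ A ∈ T, A.IsNormal) :
    (generated T).IsNormal := by
  intro h a ha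
  change a ∈ Algebra.adjoin k _ at ha
  induction ha using Algebra.adjoin_induction generalizing h with
  | mem x hx =>
    obtain ⟨A, hA, hx⟩ := Set.mem_iUnion₂.1 hx
    have hle := (isLUB_generated T).1 hA
    exact ⟨hle (hT A hA h x hx).1, hle (hT A hA h x hx).2⟩
  | algebraMap c =>
    rw [leftAdjoint_algebraMap, rightAdjoint_algebraMap]
    exact ⟨Subalgebra.algebraMap_mem _ _, Subalgebra.algebraMap_mem _ _⟩
  | add x y _ _ hx hy =>
    rw [leftAdjoint_add, rightAdjoint_add]
    exact ⟨add_mem (hx h).1 (hy h).1, add_mem (hx h).2 (hy h).2⟩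
  | mul x y _ _ hx hy =>
    rw [leftAdjoint_mul (Coalgebra.Repr.arbitrary k h),
      rightAdjoint_mul (Coalgebra.Repr.arbitrary k h)]
    exact ⟨sum_mem fun i _ ↦ mul_mem (hx _).1 (hy _).1, sum_mem fun i _ ↦ mul_mem (hx _).2 (hy _).2⟩

theorem exists_repr_mem (A : HopfSubalgebra k H) {a : H} (ha : a ∈ A.toSubalgebra) :
    ∃ (ι : Type v) (r : Coalgebra.Repr k a ι),
      (∀ i, r.left i ∈ A.toSubalgebra) ∧ ∀ i, r.right i ∈ A.toSubalgebra := by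
  let r := Coalgebra.Repr.arbitrary k (⟨a, ha⟩ : A.toSubalgebra)
  refine ⟨_, ⟨r.index, fun i ↦ r.left i, fun i ↦ r.right i, ?_⟩, fun i ↦ (r.left i).2,
    fun i ↦ (r.right i).2⟩
  rw [← A.map_comulRestrict ⟨a, ha⟩]
  change _ = Algebra.TensorProduct.map _ _ (Coalgebra.comul (R := k) (⟨a, ha⟩ : A.toSubalgebra))
  rw [← r.eq, map_sum]
  rfl

theorem counit_leftAdjoint (b a : H) : Coalgebra.counit (R := k) (leftAdjoint (k := k) b a) =
    Coalgebra.counit (R := k) a * Coalgebra.counit (R := k) b := by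
  let r := Coalgebra.Repr.arbitrary k a
  have := congrArg (Coalgebra.counit (R := k)) (Coalgebra.sum_counit_smul r)
  simp only [map_sum, map_smul, smul_eq_mul] at this
  rw [leftAdjoint_apply r, map_sum, ← this, Finset.sum_mul]
  refine Finset.sum_congr rfl fun i _ ↦ ?_
  simp only [Bialgebra.counit_mul, counit_antipode]
  ring

/-- If the normal Hopf subalgebras `A` and `B` meet in `k`, then `A` acts trivially on `B` by the
adjoint action. -/
theorem leftAdjoint_eq_of_inf_eq_bot {A B : HopfSubalgebra k H} (hA : A.IsNormal)
    (hB : B.IsNormal) (hAB : A.toSubalgebra ⊓ B.toSubalgebra = ⊥) {a b : H}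
    (ha : a ∈ A.toSubalgebra) (hb : b ∈ B.toSubalgebra) :
    leftAdjoint (k := k) b a = Coalgebra.counit (R := k) a • b := by
  let ad : H →ₗ[k] H :=
    { toFun := fun x ↦ leftAdjoint (k := k) x a
      map_add' := fun x y ↦ leftAdjoint_add x y a
      map_smul' := fun c x ↦ by
        simp only [leftAdjoint_apply (Coalgebra.Repr.arbitrary k a), RingHom.id_apply,
          Finset.smul_sum, mul_smul_comm, smul_mul_assoc] }
  -- The Hopf commutator `φ(x) = ∑ a₁ x₁ S(a₂) S(x₂)`. Grouping the first three factors puts it in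
  -- `B`, grouping the last three puts it in `A`.
  let φ : WithConv (H →ₗ[k] H) := toConv ad * toConv (antipode k)
  have hφ : φ * toConv LinearMap.id = toConv ad := by
    rw [mul_assoc, antipode_mul_id, mul_one]
  have hφB : ∀ x ∈ B.toSubalgebra, φ x = (Coalgebra.counit (R := k) a * Coalgebra.counit x) • 1 := by
    intro x hx
    obtain ⟨ι, r, hrl, hrr⟩ := A.exists_repr_mem ha
    obtain ⟨κ, s, hsl, hsr⟩ := B.exists_repr_mem hx
    have e : φ x = ∑ j ∈ s.index, leftAdjoint (k := k) (s.left j) a * antipode k (s.right j) :=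
      s.convMul_apply _ _
    have hmemB : φ x ∈ B.toSubalgebra := by
      rw [e]
      exact sum_mem fun j _ ↦ mul_mem (hB a _ (hsl j)).1 (B.antipode_mem' _ (hsr j))
    have hmemA : φ x ∈ A.toSubalgebra := by
      have : φ x = ∑ i ∈ r.index, r.left i *
          leftAdjoint (k := k) (antipode k (r.right i)) x := by
        rw [e]
        simp only [leftAdjoint_apply r, leftAdjoint_apply s, Finset.sum_mul, Finset.mul_sum]
        rw [Finset.sum_comm]
        simp only [mul_assoc]
      rw [this]
      exact sum_mem fun i _ ↦ mul_mem (hrl i) (hA x _ (A.antipode_mem' _ (hrr i))).1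
    have hbot : φ x ∈ A.toSubalgebra ⊓ B.toSubalgebra := ⟨hmemA, hmemB⟩
    rw [hAB] at hbot
    obtain ⟨c, hc⟩ := Algebra.mem_bot.1 hbot
    rw [Algebra.algebraMap_eq_smul_one] at hc
    have h1 : Coalgebra.counit (R := k) (φ x) =
        Coalgebra.counit (R := k) a * Coalgebra.counit x := by
      have := congrArg (Coalgebra.counit (R := k)) (Coalgebra.sum_counit_smul s)
      simp only [map_sum, map_smul, smul_eq_mul] at this
      rw [e, map_sum, ← this, Finset.mul_sum]
      simp only [Bialgebra.counit_mul, counit_antipode, counit_leftAdjoint, mul_assoc]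
    rw [← hc] at h1 ⊢
    rw [map_smul, Bialgebra.counit_one, smul_eq_mul, mul_one] at h1
    rw [h1]
  obtain ⟨κ, s, hsl, hsr⟩ := B.exists_repr_mem hb
  -- The action is recovered from the commutator: `ad = φ * id`.
  have h2 : ad b = ∑ j ∈ s.index, φ (s.left j) * s.right j := by
    have := LinearMap.congr_fun (congrArg ofConv hφ) b
    exact this.symm.trans (s.convMul_apply _ _)
  change ad b = _
  rw [h2]
  conv_rhs => rw [← Coalgebra.sum_counit_smul s]
  rw [Finset.smul_sum]
  exact Finset.sum_congr rfl fun j _ ↦ by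
    rw [hφB _ (hsl j), smul_mul_assoc, one_mul, mul_smul]

/-- Normal Hopf subalgebras meeting in `k` commute elementwise. -/
theorem commute_of_inf_eq_bot {A B : HopfSubalgebra k H} (hA : A.IsNormal)
    (hB : B.IsNormal) (hAB : A.toSubalgebra ⊓ B.toSubalgebra = ⊥) {a b : H}
    (ha : a ∈ A.toSubalgebra) (hb : b ∈ B.toSubalgebra) : Commute a b := by
  obtain ⟨ι, r, hrl, hrr⟩ := A.exists_repr_mem ha
  have h1 : toConv (leftAdjoint (k := k) b) * toConv LinearMap.id =
      toConv (LinearMap.mulRight k b) := by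
    rw [toConv_leftAdjoint, mul_assoc, antipode_mul_id, mul_one, id_convMul_convConst]
  -- The analogue of `ab = (aba⁻¹)a`; triviality of the action then moves `b` to the left.
  have h2 : a * b = ∑ i ∈ r.index, leftAdjoint (k := k) b (r.left i) * r.right i := by
    have := LinearMap.congr_fun (congrArg ofConv h1) a
    exact this.symm.trans (r.convMul_apply _ _)
  rw [Commute, SemiconjBy, h2]
  conv_rhs => rw [← Coalgebra.sum_counit_smul r]
  rw [Finset.mul_sum]
  exact Finset.sum_congr rfl fun i _ ↦ by
    rw [leftAdjoint_eq_of_inf_eq_bot hA hB hAB (hrl i) hb, smul_mul_assoc, mul_smul_comm]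

theorem IsMinimalNormal.inf_eq_bot_or_le {A N : HopfSubalgebra k H} (hA : A.IsMinimalNormal)
    (hN : N.IsNormal) : A.toSubalgebra ⊓ N.toSubalgebra = ⊥ ∨ A ≤ N := by
  by_cases h : A.inter N = ⊥
  · exact Or.inl (congrArg toSubalgebra h)
  · have hle : A.inter N ≤ A := fun _ hx ↦ hx.1
    exact Or.inr ((hA.2 ⟨hA.1.1.inter hN, h⟩ hle).trans fun _ hx ↦ hx.2)

theorem generated_mono {S T : Set (HopfSubalgebra k H)} (h : S ⊆ T) : generated S ≤ generated T :=
  (isLUB_generated S).2 fun _ hA ↦ (isLUB_generated T).1 (h hA)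

/-- A finite independent family of normal Hopf subalgebras generates their tensor product. -/
theorem exists_bialgHom_tensorList [FiniteDimensional k H] (l : List (HopfSubalgebra k H))
    (hnodup : l.Nodup) (hnormal : ∀ A ∈ l, A.IsNormal)
    (hind : ∀ A ∈ l, A.toSubalgebra ⊓ (generated ({B | B ∈ l} \ {A})).toSubalgebra = ⊥) :
    ∃ G : tensorList l →ₐc[k] H, (∀ x, G x = mulList l x) ∧ Function.Injective G ∧
      (G : tensorList l →ₐ[k] H).range = (generated {A | A ∈ l}).toSubalgebra := by
  induction l with
  | nil =>
    refine ⟨valHom ⊥, fun x ↦ rfl, Subtype.val_injective, ?_⟩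
    have : generated {A : HopfSubalgebra k H | A ∈ []} = ⊥ :=
      le_antisymm ((isLUB_generated _).2 fun A hA ↦ by simp at hA) bot_le
    rw [this]
    exact Subalgebra.range_val _
  | cons A l ih =>
    rw [List.nodup_cons] at hnodup
    obtain ⟨g, hg, hinj, hrange⟩ := ih hnodup.2 (fun B hB ↦ hnormal B (List.mem_cons_of_mem _ hB))
      (fun B hB ↦ by
        rw [← le_bot_iff, ← hind B (List.mem_cons_of_mem _ hB)]
        exact inf_le_inf_left _ (generated_mono
          (Set.sdiff_subset_sdiff_left fun C hC ↦ List.mem_cons_of_mem _ hC)))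
    have hset : {B | B ∈ A :: l} \ {A} = {B | B ∈ l} := by
      ext B
      simp only [List.mem_cons, Set.mem_sdiff, Set.mem_ofPred_eq, Set.mem_singleton_iff]
      constructor
      · rintro ⟨h | h, h'⟩
        · exact absurd h h'
        · exact h
      · exact fun h ↦ ⟨Or.inr h, fun e ↦ hnodup.1 (e ▸ h)⟩
    have hAl := hind A List.mem_cons_self
    rw [hset] at hAl
    have hmem : ∀ x, g x ∈ (generated {B | B ∈ l}).toSubalgebra := fun x ↦ hrange ▸ ⟨x, rfl⟩
    have hcomm : ∀ a x, Commute (A.valHom a) (g x) := fun a x ↦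
      commute_of_inf_eq_bot (hnormal A List.mem_cons_self)
        (IsNormal.generated fun B hB ↦ hnormal B (List.mem_cons_of_mem _ hB)) hAl a.2 (hmem x)
    have hR : (tensorLift A.valHom g hcomm : A.toSubalgebra ⊗[k] tensorList l →ₐ[k] H).range =
        (generated {B | B ∈ A :: l}).toSubalgebra := by
      have hA : A ≤ generated {B | B ∈ A :: l} := (isLUB_generated _).1 List.mem_cons_self
      have hl : generated {B | B ∈ l} ≤ generated {B | B ∈ A :: l} :=
        generated_mono fun C hC ↦ List.mem_cons_of_mem _ hC
      apply le_antisymm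
      · rintro _ ⟨x, rfl⟩
        change tensorLift A.valHom g hcomm x ∈ _
        induction x with
        | zero => rw [map_zero]; exact zero_mem _
        | tmul a x => exact mul_mem (hA a.2) (hl (hmem x))
        | add x y hx hy => rw [map_add]; exact add_mem hx hy
      · refine Algebra.adjoin_le (Set.iUnion₂_subset fun B hB b hb ↦ ?_)
        rcases List.mem_cons.1 hB with rfl | hB
        · refine ⟨⟨b, hb⟩ ⊗ₜ 1, ?_⟩
          change tensorLift _ g hcomm _ = b
          rw [tensorLift_tmul, map_one, mul_one]
          rfl
        · have : b ∈ (g : tensorList l →ₐ[k] H).range :=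
            hrange ▸ (isLUB_generated {B | B ∈ l}).1 hB hb
          obtain ⟨x, rfl⟩ := this
          refine ⟨1 ⊗ₜ x, ?_⟩
          change tensorLift _ g hcomm _ = g x
          rw [tensorLift_tmul, map_one, one_mul]
    refine ⟨tensorLift A.valHom g hcomm, fun x ↦ ?_,
      injective_tensorLift A.valHom g hcomm Subtype.val_injective hinj (fun a x hax ↦ ?_) _ hR, hR⟩
    · change tensorLift A.valHom g hcomm x = LinearMap.mul' k H
        (TensorProduct.map A.toSubalgebra.val.toLinearMap (mulList l) x)
      change A.toSubalgebra ⊗[k] tensorList l at x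
      induction x with
      | zero => rw [map_zero, map_zero, map_zero]
      | tmul a x => exact congrArg (_ * ·) (hg x)
      | add x y hx hy => rw [map_add, hx, hy, map_add, map_add]
    · have : A.valHom a ∈ A.toSubalgebra ⊓ (generated {B | B ∈ l}).toSubalgebra :=
        ⟨a.2, hax ▸ hmem x⟩
      rw [hAl] at this
      obtain ⟨c, hc⟩ := Algebra.mem_bot.1 this
      exact ⟨c, by rw [← hc, Algebra.algebraMap_eq_smul_one]⟩

/-! ### Choosing an independent generating family for the socle -/

theorem exists_finset_generated_eq_socle [FiniteDimensional k H] :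
    ∃ s : Finset (HopfSubalgebra k H), (∀ A ∈ s, A.IsMinimalNormal) ∧
      generated (s : Set (HopfSubalgebra k H)) = socle k H := by
  classical
  -- By finite dimension some finite family generates a maximal subspace; adjoining another minimal
  -- normal Hopf subalgebra cannot enlarge it.
  obtain ⟨s, hs, hmax⟩ := (InvImage.wf (fun s : Finset (HopfSubalgebra k H) ↦
      Subalgebra.toSubmodule (generated (s : Set (HopfSubalgebra k H))).toSubalgebra)
    (wellFounded_gt (α := Submodule k H))).has_min {s | ∀ A ∈ s, A.IsMinimalNormal}
    ⟨∅, fun A hA ↦ absurd hA (Finset.notMem_empty A)⟩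
  refine ⟨s, hs, le_antisymm (generated_mono fun A hA ↦ hs A hA) ?_⟩
  refine (isLUB_generated {A : HopfSubalgebra k H | A.IsMinimalNormal}).2 fun A hA ↦ ?_
  have hmin : ∀ B ∈ insert A s, B.IsMinimalNormal := fun B hB ↦
    (Finset.mem_insert.1 hB).elim (fun h ↦ h ▸ hA) (hs B)
  have hle : generated (s : Set (HopfSubalgebra k H)) ≤
      generated ((insert A s : Finset (HopfSubalgebra k H)) : Set (HopfSubalgebra k H)) :=
    generated_mono (Finset.coe_subset.2 (Finset.subset_insert A s))
  have hA' : A ≤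
      generated ((insert A s : Finset (HopfSubalgebra k H)) : Set (HopfSubalgebra k H)) :=
    (isLUB_generated _).1 (Finset.mem_coe.2 (Finset.mem_insert_self A s))
  have heq := toSubalgebra_injective
    (Subalgebra.toSubmodule_injective (eq_of_le_of_not_lt hle (hmax _ hmin)))
  rwa [← heq] at hA'

theorem exists_independent_finset_generated_eq_socle [FiniteDimensional k H] :
    ∃ s : Finset (HopfSubalgebra k H), (∀ A ∈ s, A.IsMinimalNormal) ∧
      generated (s : Set (HopfSubalgebra k H)) = socle k H ∧
      ∀ A ∈ s, A.toSubalgebra ⊓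
        (generated ((s : Set (HopfSubalgebra k H)) \ {A})).toSubalgebra = ⊥ := by
  classical
  obtain ⟨s, ⟨hs, hgen⟩, hmin⟩ := (InvImage.wf Finset.card (wellFounded_lt (α := ℕ))).has_min
    {s : Finset (HopfSubalgebra k H) | (∀ A ∈ s, A.IsMinimalNormal) ∧
      generated (s : Set (HopfSubalgebra k H)) = socle k H} exists_finset_generated_eq_socle
  refine ⟨s, hs, hgen, fun A hA ↦ ?_⟩
  have hN : (generated ((s : Set (HopfSubalgebra k H)) \ {A})).IsNormal :=
    IsNormal.generated fun B hB ↦ (hs B hB.1).1.1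
  -- If `A` lay in what the others generate, it could be dropped, contradicting least cardinality.
  refine ((hs A hA).inf_eq_bot_or_le hN).resolve_right fun hle ↦ ?_
  have hgen' : generated ((s : Set (HopfSubalgebra k H)) \ {A}) = socle k H := by
    rw [← hgen]
    refine le_antisymm (generated_mono Set.sdiff_subset)
      ((isLUB_generated (s : Set (HopfSubalgebra k H))).2 fun B hB ↦ ?_)
    by_cases h : B = A
    · exact h ▸ hle
    · exact (isLUB_generated ((s : Set (HopfSubalgebra k H)) \ {A})).1 ⟨hB, h⟩
  exact hmin (s.erase A) ⟨fun B hB ↦ hs B (Finset.mem_of_mem_erase hB),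
    by rw [Finset.coe_erase, hgen']⟩ (Finset.card_erase_lt_of_mem hA)

/-- An injective map of Hopf algebras is an isomorphism onto its range. -/
theorem exists_bialgEquiv_of_range_eq {P : Type w} [Ring P] [HopfAlgebra k P] (G : P →ₐc[k] H)
    (hinj : Function.Injective G) (D : HopfSubalgebra k H)
    (hrange : (G : P →ₐ[k] H).range = D.toSubalgebra) :
    ∃ e : P ≃ₐc[k] D.toSubalgebra, ∀ x, (e x : H) = G x := by
  have hmem : ∀ x, G x ∈ D.toSubalgebra := fun x ↦ hrange ▸ ⟨x, rfl⟩
  have hbij : Function.Bijective (codRestrict G D hmem) := by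
    refine ⟨fun x y hxy ↦ hinj (congrArg Subtype.val hxy), ?_⟩
    rintro ⟨y, hy⟩
    rw [← hrange] at hy
    obtain ⟨x, rfl⟩ := hy
    exact ⟨x, rfl⟩
  refine ⟨BialgEquiv.ofBijective _ hbij, fun x ↦ ?_⟩
  rw [BialgEquiv.coe_ofBijective, coe_codRestrict]

end HopfSubalgebra

theorem theorem5p2 {k : Type u} {H : Type v} [Field k] [IsAlgClosed k] [CharZero k]
    [Ring H] [HopfAlgebra k H] [IsSemisimpleRing H] :
    ∃ l : List (HopfSubalgebra k H), l.Nodup ∧ (∀ A ∈ l, A.IsMinimalNormal) ∧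
      HopfSubalgebra.IsInternalTensorProduct {A | A ∈ l} (HopfSubalgebra.socle k H) ∧
      ∃ e : HopfSubalgebra.tensorList l ≃ₐc[k] (HopfSubalgebra.socle k H).toSubalgebra,
        ∀ x, (e x : H) = HopfSubalgebra.mulList l x := by
  have : FiniteDimensional k H := HopfAlgebra.finite_of_isSemisimpleRing
  obtain ⟨s, hs, hgen, hind⟩ :=
    HopfSubalgebra.exists_independent_finset_generated_eq_socle (k := k) (H := H)
  have hset : {A | A ∈ s.toList} = (s : Set (HopfSubalgebra k H)) := by
    ext A
    simp
  have hind' : ∀ A ∈ s.toList, A.toSubalgebra ⊓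
      (HopfSubalgebra.generated ({B | B ∈ s.toList} \ {A})).toSubalgebra = ⊥ :=
    fun A hA ↦ hset ▸ hind A (Finset.mem_toList.1 hA)
  obtain ⟨G, hG, hinj, hrange⟩ := HopfSubalgebra.exists_bialgHom_tensorList s.toList
    s.nodup_toList (fun A hA ↦ (hs A (Finset.mem_toList.1 hA)).1.1) hind'
  rw [hset, hgen] at hrange
  obtain ⟨e, he⟩ := HopfSubalgebra.exists_bialgEquiv_of_range_eq G hinj _ hrange
  exact ⟨s.toList, s.nodup_toList, fun A hA ↦ hs A (Finset.mem_toList.1 hA),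
    ⟨by rw [hset, hgen], hind'⟩, e, fun x ↦ (he x).trans (hG x)⟩
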